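/- Fix a base $b\ge 2$. A string tuple $(w_1,\dots,w_k)$ over an alphabet $\Gamma$ is convoluted by reading the strings in parallel, position by position, shorter strings being padded at the end by a symbol $\#\notin\Gamma$; a relation on strings is *automatic* if the set of the convolutions of its members is a regular language, and a function on strings is automatic if its graph is. A *deterministic automatic register machine* (DARM) has a finite alphabet $\Gamma$ containing its input alphabet, finitely many registers, each holding a string over $\Gamma$ and initially empty, and a finite program whose lines are of the forms: read the input string into a register; write the content of a register to the output (successive writes are concatenated); assign to a register a constant string over the input alphabet, the content of another register, or the value of an automatic function at the contents of some registers; jump unconditionally; jump if an automatic predicate holds of the contents of some registers; halt, halt and accept, or halt and reject. Each execution of one line is one step. A DARM produces the output $y$ on input $x$ in $t$ steps if it halts, not rejecting, in its $t$-th step and has then written $y$. A list of $n$ numbers with $m$ base-$b$ digits each (most significant digit first, leading zeros allowed) is presented as the string of the $n$ digit blocks, each followed by a separator symbol. A DARM *sorts* if for all $n,m\ge 1$ and each such list as input it produces as output the list of the same numbers in nondecreasing order, in the same format. **Theorem.** 1. There are a DARM and a constant $C$ such that, for all $n,m\ge1$, the DARM sorts every list of $n$ numbers with $m$ digits in at most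 $C\,nm$ steps. 2. This is matched by a lower bound: for every DARM that sorts and every $\varepsilon>0$ there is a constant $c>0$ such that for all $n\ge 2$ and all $m\ge(1+\varepsilon)\log_b n$ there is a list of $n$ numbers with $m$ digits on which this DARM takes at least $c\,nm$ steps. -/

import Mathlib

/-- The convolution of `k` strings: position `j` holds the tuple of the `j`-th symbols, where a
string that is already exhausted is padded by `none` (the padding symbol `#`). Its length is the
maximum of the lengths of the strings. -/
def convolution {A : Type} {k : ℕ} (w : Fin k → List A) : List (Fin k → Option A) :=
  List.ofFn fun (j : Fin (Finset.univ.sup fun i => (w i).length)) i => (w i)[(j : ℕ)]?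

/-- A `k`-ary relation on strings is automatic iff the set of the convolutions of its members is a
regular language. -/
def IsAutomaticRel {A : Type} {k : ℕ} (R : Set (Fin k → List A)) : Prop :=
  Language.IsRegular (convolution '' R : Set (List (Fin k → Option A)))

/-- A `k`-ary function on strings is automatic iff its graph is an automatic relation. -/
def IsAutomaticFun {A : Type} {k : ℕ} (f : (Fin k → List A) → List A) : Prop :=
  IsAutomaticRel {w : Fin (k + 1) → List A | w (Fin.last k) = f (Fin.init w)}

/-- A `k`-ary automatic function on strings over `A`. -/
structure AutomaticFun (A : Type) (k : ℕ) where
  toFun : (Fin k → List A) → List A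
  automatic : IsAutomaticFun toFun

/-- A `k`-ary automatic predicate on strings over `A`. -/
structure AutomaticPred (A : Type) (k : ℕ) where
  holds : Set (Fin k → List A)
  automatic : IsAutomaticRel holds

/-- Instructions with `r` registers, input alphabet `S` and machine alphabet `A`. Line numbers are
natural numbers starting at `0`. -/
inductive Instr (S A : Type) (r : ℕ) : Type
  /-- `read(R_i)`: put the input string into register `i` -/
  | read (i : Fin r) : Instr S A r
  /-- `write(R_i)`: write the string in register `i` to the output -/
  | write (i : Fin r) : Instr S A r
  /-- `R_i ← w` -/
  | const (i : Fin r) (w : List S) : Instr S A r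
  /-- `R_i ← R_j` -/
  | copy (i j : Fin r) : Instr S A r
  /-- `R_i ← F(R_{args 0}, …, R_{args (k-1)})` for an automatic function `F` -/
  | apply (i : Fin r) {k : ℕ} (F : AutomaticFun A k) (args : Fin k → Fin r) : Instr S A r
  /-- `goto(l)` -/
  | goto (l : ℕ) : Instr S A r
  /-- `if F(R_{args 0}, …, R_{args (k-1)}) then goto(l)` for an automatic predicate `F` -/
  | ifGoto {k : ℕ} (F : AutomaticPred A k) (args : Fin k → Fin r) (l : ℕ) : Instr S A r
  | halt : Instr S A r
  | haltAccept : Instr S A r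
  | haltReject : Instr S A r

/-- A deterministic automatic register machine with input alphabet `S`. Its finite set of operations
consists of the automatic functions and predicates that occur in its program. -/
structure DARM (S : Type) where
  /-- the machine alphabet -/
  Alphabet : Type
  finite_alphabet : Finite Alphabet
  /-- the input alphabet is a part of the machine alphabet -/
  incl : S ↪ Alphabet
  /-- the number of registers -/
  numRegs : ℕ
  program : List (Instr S Alphabet numRegs)

inductive RunStatus : Type
  | running
  | halted
  | accepted
  | rejected

/-- A configuration: the current line number, the contents of the registers, the output written so
far, and whether the machine has halted. -/
structure Config (A : Type) (r : ℕ) where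
  line : ℕ
  reg : Fin r → List A
  out : List A
  status : RunStatus

namespace DARM

variable {S : Type} (M : DARM S)

/-- Initially all registers and the output are empty, and the first line is executed next. -/
def init : Config M.Alphabet M.numRegs where
  line := 0
  reg := fun _ => []
  out := []
  status := .running

open Classical in
/-- The effect of one instruction on a configuration, where `x` is the input string. -/
noncomputable def exec (x : List S) (c : Config M.Alphabet M.numRegs) :
    Instr S M.Alphabet M.numRegs → Config M.Alphabet M.numRegs
  | .read i => { c with line := c.line + 1, reg := Function.update c.reg i (x.map M.incl) }
  | .write i => { c with line := c.line + 1, out := c.out ++ c.reg i }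
  | .const i w => { c with line := c.line + 1, reg := Function.update c.reg i (w.map M.incl) }
  | .copy i j => { c with line := c.line + 1, reg := Function.update c.reg i (c.reg j) }
  | .apply i F args =>
      { c with
        line := c.line + 1
        reg := Function.update c.reg i (F.toFun fun a => c.reg (args a)) }
  | .goto l => { c with line := l }
  | .ifGoto F args l =>
      { c with line := if (fun a => c.reg (args a)) ∈ F.holds then l else c.line + 1 }
  | .halt => { c with status := .halted }
  | .haltAccept => { c with status := .accepted }
  | .haltReject => { c with status := .rejected }

/-- One step executes the instruction in the current line. A machine that has halted, or whose
current line does not exist, stays as it is (in the latter case it never halts). -/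
noncomputable def step (x : List S) (c : Config M.Alphabet M.numRegs) :
    Config M.Alphabet M.numRegs :=
  match c.status, M.program[c.line]? with
  | .running, some I => M.exec x c I
  | _, _ => c

/-- The configuration after `t` steps on input `x`. -/
noncomputable def run (x : List S) (t : ℕ) : Config M.Alphabet M.numRegs :=
  (M.step x)^[t] M.init

/-- On input `x` the machine halts (without rejecting) after exactly `t` steps, with output `y`. -/
def OutputsInSteps (x y : List S) (t : ℕ) : Prop :=
  (∀ s < t, (M.run x s).status = .running) ∧
    ((M.run x t).status = .halted ∨ (M.run x t).status = .accepted) ∧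
    (M.run x t).out = y.map M.incl

end DARM

/-- The value of an `m`-digit number in base `b`, most significant digit first. Leading zeros are
allowed. -/
def numValue {b m : ℕ} (d : Fin m → Fin b) : ℕ :=
  ∑ j, (d j : ℕ) * b ^ (j.rev : ℕ)

/-- The `n` given `m`-digit numbers in nondecreasing order. -/
def sortNumbers {b n m : ℕ} (x : Fin n → Fin m → Fin b) : Fin n → Fin m → Fin b :=
  x ∘ Tuple.sort fun i => numValue (x i)

/-- A list of `n` numbers with `m` digits as one string over the `b` digits and one further symbol
`Sum.inr ()`, the separator, which ends each number. -/
def encodeNumbers {b n m : ℕ} (x : Fin n → Fin m → Fin b) : List (Fin b ⊕ Unit) :=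
  (List.ofFn fun i => (List.ofFn fun j => Sum.inl (x i j)) ++ [Sum.inr ()]).flatten

/-- The machine sorts the `n` numbers `x` in exactly `t` steps. -/
def DARM.SortsInSteps {b n m : ℕ} (M : DARM (Fin b ⊕ Unit)) (x : Fin n → Fin m → Fin b) (t : ℕ) :
    Prop :=
  M.OutputsInSteps (encodeNumbers x) (encodeNumbers (sortNumbers x)) t

/-! Lower bound: cut all strings at a position `p`. A finite automaton reading a convolution carries
only boundedly much information across the cut, so one step changes the part left of `p` in a way
determined by that part and one of finitely many messages from the right; the number of messages
does not depend on `p`. Inputs that agree left of `p` thus reach at most `K ^ t` left parts after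
`t` steps (`exists_card_leftPart_le`). Take `n - k` maximal numbers followed by `k = n / 2`
arbitrary ones and cut after the maximal ones. Sorting must carry the arbitrary numbers across the
cut (`exists_sortNumbers_padFront_eq`), and up to their order, at most `k ^ k` possibilities, they
can be read off the left part of the output. Hence `(b ^ m) ^ k ≤ K ^ T * k ^ k`, and for `m ≥ (1 +
ε) log_b n` the factor `k ^ k` absorbs only a fraction of `b ^ (m * k)` on the logarithmic scale, so
`T` is of order `n * m`.

Upper bound: selection sort in which one automatic function updates all numbers at once. A round
marks the first letter of every remaining number, then repeatedly writes the least marked digit and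
advances the marks that stand at it. After `m` digits the marked numbers are the copies of the
minimum; one of them is deleted. A round needs `m + 2` passes of four steps each, and there are `n`
rounds. The pass is automatic because each new letter depends on finite information about the
letters before it, the letters after it and the whole string (`isAutomaticFun_contextMap`). -/

/-! ### Convolutions, and the information that an automatic function carries across a cut -/

theorem length_convolution {A : Type} {k : ℕ} (w : Fin k → List A) :
    (convolution w).length = Finset.univ.sup fun i => (w i).length := by
  simp [convolution]

theorem length_le_length_convolution {A : Type} {k : ℕ} (w : Fin k → List A) (i : Fin k) :
    (w i).length ≤ (convolution w).length := by
  rw [length_convolution]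
  exact Finset.le_sup (f := fun i => (w i).length) (Finset.mem_univ i)

theorem getElem?_convolution_bind {A : Type} {k : ℕ} (w : Fin k → List A) (i : Fin k) (j : ℕ) :
    ((convolution w)[j]?).bind (fun c => c i) = (w i)[j]? := by
  by_cases h : j < (convolution w).length
  · rw [List.getElem?_eq_getElem h]
    simp [convolution]
  · have h' := length_le_length_convolution w i
    rw [List.getElem?_eq_none (by omega), List.getElem?_eq_none (by omega)]
    rfl

/-- The first `p` symbols of the value of an automatic function depend only on the first `p` symbols
of the arguments and on one of finitely many messages about the remaining symbols. -/
theorem AutomaticFun.exists_message {A : Type} {k : ℕ} (f : AutomaticFun A k) :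
    ∃ Msg : Type, Finite Msg ∧ ∀ p : ℕ, ∃ μ : (Fin k → List A) → Msg,
      ∀ w w' : Fin k → List A, (∀ i, (w i).take p = (w' i).take p) → μ w = μ w' →
        (f.toFun w).take p = (f.toFun w').take p := by
  obtain ⟨σ, _, D, hD⟩ := f.automatic
  let v : (Fin k → List A) → Fin (k + 1) → List A := fun w => Fin.snoc w (f.toFun w)
  have hv : ∀ w, v w ∈ {w : Fin (k + 1) → List A | w (Fin.last k) = f.toFun (Fin.init w)} := by
    intro w
    simp [v]
  -- The message is the set of states from which the rest of the convolution is accepted, and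
  -- whether the convolution reaches the cut.
  refine ⟨Set σ × Prop, inferInstance, fun p => ⟨fun w =>
    ({q | D.evalFrom q ((convolution (v w)).drop p) ∈ D.accept},
      p ≤ (convolution (v w)).length), ?_⟩⟩
  intro w w' hw hμ
  obtain ⟨h1, h2⟩ := Prod.mk.inj hμ
  have hmem : ∀ w, convolution (v w) ∈ D.accepts := fun w => by
    rw [hD]; exact ⟨v w, hv w, rfl⟩
  by_cases hp : p ≤ (convolution (v w)).length
  -- Equal messages let the left part of one convolution be spliced to the right part of the other.
  -- The result is the convolution of a tuple `u` of the graph. Its arguments are `w'`, so its last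
  -- entry is the value at `w'`, but left of `p` that entry is copied from the value at `w`.
  · have hacc : (convolution (v w)).take p ++ (convolution (v w')).drop p ∈ D.accepts := by
      have h := hmem w
      rw [DFA.mem_accepts, DFA.eval] at h ⊢
      rw [← List.take_append_drop p (convolution (v w)), DFA.evalFrom_of_append] at h
      rw [DFA.evalFrom_of_append]
      exact (Set.ext_iff.1 h1 _).1 h
    rw [hD] at hacc
    obtain ⟨u, hu, hconv⟩ := hacc
    have hlo : ∀ i j, j < p → (u i)[j]? = (v w i)[j]? := by
      intro i j hj
      rw [← getElem?_convolution_bind, hconv, List.getElem?_append_left (by simp; omega),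
        List.getElem?_take_of_lt hj, getElem?_convolution_bind]
    have hhi : ∀ i j, p ≤ j → (u i)[j]? = (v w' i)[j]? := by
      intro i j hj
      rw [← getElem?_convolution_bind, hconv, List.getElem?_append_right (by simp; omega),
        List.getElem?_drop, ← getElem?_convolution_bind (v w')]
      congr 3
      simp; omega
    have hinit : Fin.init u = w' := by
      funext i
      refine List.ext_getElem? fun j => ?_
      by_cases hj : j < p
      · have := hlo i.castSucc j hj
        rw [Fin.init, this, ← List.getElem?_take_of_lt hj, ← List.getElem?_take_of_lt (l := w' i) hj,
          ← hw]
        simp only [v, Fin.snoc_castSucc]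
      · rw [Fin.init, hhi _ _ (by omega)]
        simp [v]
    have hu' : u (Fin.last k) = f.toFun w' := by rw [← hinit]; exact hu
    refine List.ext_getElem? fun j => ?_
    by_cases hj : j < p
    · rw [List.getElem?_take_of_lt hj, List.getElem?_take_of_lt hj, ← hu', hlo _ _ hj]
      simp [v]
    · rw [List.getElem?_eq_none (by simp; omega), List.getElem?_eq_none (by simp; omega)]
  -- Here nothing lies right of the cut, so the arguments coincide.
  · have hp' : ¬ p ≤ (convolution (v w')).length := by rwa [← h2]
    have : w = w' := by
      funext i
      have h3 := length_le_length_convolution (v w) i.castSucc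
      have h4 := length_le_length_convolution (v w') i.castSucc
      have e3 : v w i.castSucc = w i := by simp [v]
      have e4 : v w' i.castSucc = w' i := by simp [v]
      rw [e3] at h3
      rw [e4] at h4
      have := hw i
      rwa [List.take_of_length_le (by omega), List.take_of_length_le (by omega)] at this
    rw [this]

/-! ### Counting the left parts of configurations -/

namespace DARM

variable {S : Type} (M : DARM S)

/-- The part of a configuration that lies within the first `p` positions of all strings. -/
def leftPart (p : ℕ) (c : Config M.Alphabet M.numRegs) : Config M.Alphabet M.numRegs where
  line := c.line
  reg := fun i => (c.reg i).take p
  out := c.out.take p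
  status := c.status

theorem leftPart_eq_iff {p : ℕ} {c c' : Config M.Alphabet M.numRegs} :
    M.leftPart p c = M.leftPart p c' ↔ c.line = c'.line ∧
      (∀ i, (c.reg i).take p = (c'.reg i).take p) ∧ c.out.take p = c'.out.take p ∧
      c.status = c'.status := by
  simp [leftPart, funext_iff]

/-- Only automatic functions and predicates look beyond the cut; for a predicate the message is its
truth value. Writing needs no message: appending moves symbols only to the right. -/
theorem exists_message_exec (I : Instr S M.Alphabet M.numRegs) :
    ∃ Msg : Type, Finite Msg ∧ ∀ p : ℕ, ∃ μ : Config M.Alphabet M.numRegs → Msg,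
      ∀ (x x' : List S) (c c' : Config M.Alphabet M.numRegs), x.take p = x'.take p →
        M.leftPart p c = M.leftPart p c' → μ c = μ c' →
        M.leftPart p (M.exec x c I) = M.leftPart p (M.exec x' c' I) := by
  have upd : ∀ (p : ℕ) (c c' : Config M.Alphabet M.numRegs) (i : Fin M.numRegs)
      (u u' : List M.Alphabet), (∀ i, (c.reg i).take p = (c'.reg i).take p) →
      u.take p = u'.take p →
      ∀ j, (Function.update c.reg i u j).take p = (Function.update c'.reg i u' j).take p := by
    intro p c c' i u u' h hu j
    by_cases hj : j = i
    · subst hj; simpa using hu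
    · simpa [hj] using h j
  cases I with
  | apply i F args =>
    obtain ⟨Msg, hfin, h⟩ := F.exists_message
    refine ⟨Msg, hfin, fun p => ?_⟩
    obtain ⟨μ, hμ⟩ := h p
    refine ⟨fun c => μ fun a => c.reg (args a), ?_⟩
    intro x x' c c' _ hc hm
    rw [leftPart_eq_iff] at hc ⊢
    obtain ⟨h1, h2, h3, h4⟩ := hc
    refine ⟨by simp [exec, h1], ?_, by simpa [exec] using h3, by simpa [exec] using h4⟩
    exact upd p c c' i _ _ h2 (hμ _ _ (fun a => h2 _) hm)
  | ifGoto F args l =>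
    refine ⟨Prop, inferInstance, fun p => ⟨fun c => (fun a => c.reg (args a)) ∈ F.holds, ?_⟩⟩
    intro x x' c c' _ hc hm
    rw [leftPart_eq_iff] at hc ⊢
    obtain ⟨h1, h2, h3, h4⟩ := hc
    refine ⟨?_, h2, h3, h4⟩
    simp only [exec, h1]
    have hm' := iff_of_eq hm
    by_cases h : (fun a => c.reg (args a)) ∈ F.holds
    · rw [if_pos h, if_pos (hm'.1 h)]
    · rw [if_neg h, if_neg (mt hm'.2 h)]
  | read i =>
    refine ⟨Unit, inferInstance, fun p => ⟨fun _ => (), ?_⟩⟩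
    intro x x' c c' hx hc _
    rw [leftPart_eq_iff] at hc ⊢
    obtain ⟨h1, h2, h3, h4⟩ := hc
    refine ⟨by simp [exec, h1], ?_, h3, h4⟩
    exact upd p c c' i _ _ h2 (by rw [← List.map_take, ← List.map_take, hx])
  | write i =>
    refine ⟨Unit, inferInstance, fun p => ⟨fun _ => (), ?_⟩⟩
    intro x x' c c' hx hc _
    rw [leftPart_eq_iff] at hc ⊢
    obtain ⟨h1, h2, h3, h4⟩ := hc
    refine ⟨by simp [exec, h1], h2, ?_, h4⟩
    have key : ∀ u v : List M.Alphabet, (u ++ v).take p = (u.take p ++ v.take p).take p := by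
      intro u v
      simp only [List.take_append, List.take_take, min_self, List.length_take]
      congr 2
      omega
    simp only [exec]
    rw [key, h3, h2 i, ← key]
  | const i w =>
    refine ⟨Unit, inferInstance, fun p => ⟨fun _ => (), ?_⟩⟩
    intro x x' c c' hx hc _
    rw [leftPart_eq_iff] at hc ⊢
    obtain ⟨h1, h2, h3, h4⟩ := hc
    exact ⟨by simp [exec, h1], upd p c c' i _ _ h2 rfl, h3, h4⟩
  | copy i j =>
    refine ⟨Unit, inferInstance, fun p => ⟨fun _ => (), ?_⟩⟩
    intro x x' c c' hx hc _
    rw [leftPart_eq_iff] at hc ⊢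
    obtain ⟨h1, h2, h3, h4⟩ := hc
    exact ⟨by simp [exec, h1], upd p c c' i _ _ h2 (h2 j), h3, h4⟩
  | goto l =>
    refine ⟨Unit, inferInstance, fun p => ⟨fun _ => (), ?_⟩⟩
    intro x x' c c' hx hc _
    rw [leftPart_eq_iff] at hc ⊢
    obtain ⟨h1, h2, h3, h4⟩ := hc
    exact ⟨rfl, h2, h3, h4⟩
  | _ =>
    refine ⟨Unit, inferInstance, fun p => ⟨fun _ => (), ?_⟩⟩
    intro x x' c c' hx hc _
    rw [leftPart_eq_iff] at hc ⊢
    obtain ⟨h1, h2, h3, h4⟩ := hc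
    exact ⟨h1, h2, h3, rfl⟩

/-- The current line belongs to the left part, so it suffices to send the messages for all lines of
the program at once. -/
theorem exists_message_step :
    ∃ Msg : Type, Finite Msg ∧ ∀ p : ℕ, ∃ μ : Config M.Alphabet M.numRegs → Msg,
      ∀ (x x' : List S) (c c' : Config M.Alphabet M.numRegs), x.take p = x'.take p →
        M.leftPart p c = M.leftPart p c' → μ c = μ c' →
        M.leftPart p (M.step x c) = M.leftPart p (M.step x' c') := by
  choose Msg hfin h using M.exists_message_exec
  refine ⟨∀ i : Fin M.program.length, Msg (M.program.get i), inferInstance, fun p => ?_⟩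
  choose μ hμ using fun I => h I p
  refine ⟨fun c i => μ (M.program.get i) c, fun x x' c c' hx hc hm => ?_⟩
  obtain ⟨h1, h2, h3, h4⟩ := M.leftPart_eq_iff.1 hc
  unfold step
  rw [← h4, ← h1]
  by_cases hl : c.line < M.program.length
  · rw [List.getElem?_eq_getElem hl]
    cases c.status with
    | running => exact hμ _ x x' c c' hx hc (congrFun hm ⟨c.line, hl⟩)
    | _ => exact hc
  · rw [List.getElem?_eq_none (by omega)]
    cases c.status <;> exact hc

/-- Over inputs that agree on the first `p` symbols, the number of left parts that can occur after
`t` steps is at most exponential in `t`. -/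
theorem exists_card_leftPart_le :
    ∃ K : ℕ, 2 ≤ K ∧ ∀ (p : ℕ) {Y : Type} [Finite Y] (x : Y → List S),
      (∀ y y', (x y).take p = (x y').take p) →
      ∀ t : ℕ, (Set.range fun y => M.leftPart p (M.run (x y) t)).ncard ≤ K ^ t := by
  obtain ⟨Msg, hfin, h⟩ := M.exists_message_step
  -- Each step multiplies the count by at most the number of messages; the summand 2 keeps `log K`
  -- positive later.
  refine ⟨Nat.card Msg + 2, by omega, fun p Y _ x hx t => ?_⟩
  obtain ⟨μ, hμ⟩ := h p
  induction t with
  | zero =>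
    rw [pow_zero]
    refine (Set.ncard_le_one (Set.finite_range _)).2 ?_
    rintro _ ⟨y, rfl⟩ _ ⟨y', rfl⟩
    rfl
  | succ t ih =>
    set A := Set.range fun y => M.leftPart p (M.run (x y) t) with hA
    have hdet : ∀ y y', M.leftPart p (M.run (x y) t) = M.leftPart p (M.run (x y') t) →
        μ (M.run (x y) t) = μ (M.run (x y') t) →
        M.leftPart p (M.run (x y) (t + 1)) = M.leftPart p (M.run (x y') (t + 1)) := by
      intro y y' h1 h2
      simp only [run, Function.iterate_succ_apply']
      exact hμ _ _ _ _ (hx y y') h1 h2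
    let B := Set.range fun y => (M.leftPart p (M.run (x y) t), μ (M.run (x y) t))
    have hBA : B ⊆ A ×ˢ Set.univ := by
      rintro _ ⟨y, rfl⟩
      exact ⟨⟨y, rfl⟩, trivial⟩
    have hB : B.ncard ≤ A.ncard * Nat.card Msg := by
      refine (Set.ncard_le_ncard hBA ((Set.finite_range _).prod Set.finite_univ)).trans ?_
      rw [Set.ncard_prod, Set.ncard_univ]
    have hle : (Set.range fun y => M.leftPart p (M.run (x y) (t + 1))).ncard ≤ B.ncard := by
      classical
      -- A representative input for each pair of left part and message; the `else` value below is
      -- never used.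
      choose g hg using fun z : B => z.2
      have hBfin : B.Finite := Set.finite_range _
      refine (Set.ncard_le_ncard ?_ (hBfin.image
        (fun z => if hz : z ∈ B then M.leftPart p (M.run (x (g ⟨z, hz⟩)) (t + 1))
          else z.1))).trans (Set.ncard_image_le hBfin)
      rintro _ ⟨y, rfl⟩
      refine ⟨_, ⟨y, rfl⟩, ?_⟩
      have hz : (M.leftPart p (M.run (x y) t), μ (M.run (x y) t)) ∈ B := ⟨y, rfl⟩
      have := hg ⟨_, hz⟩
      simp only [Prod.mk.injEq] at this
      simp only [hz]
      exact hdet _ _ this.1 this.2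
    calc _ ≤ A.ncard * Nat.card Msg := hle.trans hB
      _ ≤ _ := by rw [pow_succ]; gcongr; omega

theorem step_of_status_ne {x : List S} {c : Config M.Alphabet M.numRegs}
    (h : c.status ≠ .running) : M.step x c = c := by
  unfold step
  split
  · next heq _ => exact absurd heq h
  · rfl

theorem run_add (x : List S) (s t : ℕ) : M.run x (s + t) = (M.step x)^[t] (M.run x s) := by
  simp only [run]
  rw [add_comm, Function.iterate_add_apply]

theorem run_eq_of_status_ne {x : List S} {t s : ℕ} (h : (M.run x t).status ≠ .running)
    (hs : t ≤ s) : M.run x s = M.run x t := by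
  obtain ⟨d, rfl⟩ := Nat.exists_eq_add_of_le hs
  rw [run_add]
  exact Function.iterate_fixed (M.step_of_status_ne h) d

end DARM

/-! ### Values of digit strings and positions in the encoding -/

/-- The value of a string of digits in base `b`, most significant digit first. -/
def digitsValue {b : ℕ} : List (Fin b) → ℕ
  | [] => 0
  | d :: w => d * b ^ w.length + digitsValue w

theorem digitsValue_ofFn {b m : ℕ} (x : Fin m → Fin b) :
    digitsValue (List.ofFn x) = numValue x := by
  induction m with
  | zero => simp [digitsValue, numValue]
  | succ m ih =>
    rw [List.ofFn_succ, digitsValue, ih, numValue, numValue, Fin.sum_univ_succ]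
    simp [Fin.rev_succ]

theorem digitsValue_lt {b : ℕ} (w : List (Fin b)) : digitsValue w < b ^ w.length := by
  induction w with
  | nil => simp [digitsValue]
  | cons d w ih =>
    rw [digitsValue, List.length_cons, pow_succ']
    calc _ < d * b ^ w.length + b ^ w.length := by omega
      _ = (d + 1) * b ^ w.length := by ring
      _ ≤ _ := Nat.mul_le_mul_right _ d.isLt

/-- One unit of the leading digit outweighs all later digits together. -/
theorem head_le_of_digitsValue_le {b : ℕ} {d d' : Fin b} {w w' : List (Fin b)}
    (hl : w.length = w'.length) (h : digitsValue (d :: w) ≤ digitsValue (d' :: w')) : d ≤ d' := by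
  by_contra hd
  have hd' : (d' : ℕ) + 1 ≤ d := Fin.lt_def.1 (not_le.1 hd)
  have h1 := digitsValue_lt w'
  have h2 := Nat.mul_le_mul_right (b ^ w'.length) hd'
  rw [digitsValue, digitsValue, hl] at h
  rw [add_mul, one_mul] at h2
  omega

theorem digitsValue_injective {b : ℕ} {w w' : List (Fin b)} (hl : w.length = w'.length)
    (h : digitsValue w = digitsValue w') : w = w' := by
  induction w generalizing w' with
  | nil => exact (List.length_eq_zero_iff.1 hl.symm).symm
  | cons d w ih =>
    cases w' with
    | nil => simp at hl
    | cons d' w' =>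
      have hl' : w.length = w'.length := by simpa using hl
      have hd : d = d' := le_antisymm (head_le_of_digitsValue_le hl' h.le)
        (head_le_of_digitsValue_le hl'.symm h.ge)
      subst hd
      rw [digitsValue, digitsValue, hl'] at h
      rw [ih hl' (by omega)]

/-- For strings of equal length with a common prefix, the order of the values is decided by the
next digit. -/
theorem getElem_le_of_digitsValue_le {b j : ℕ} {w w' : List (Fin b)} (hl : w.length = w'.length)
    (hj : w.take j = w'.take j) (hlt : j < w.length) (hlt' : j < w'.length)
    (h : digitsValue w ≤ digitsValue w') : w[j] ≤ w'[j] := by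
  induction j generalizing w w' with
  | zero =>
    cases w with
    | nil => simp at hlt
    | cons d w =>
      cases w' with
      | nil => simp at hlt'
      | cons d' w' => exact head_le_of_digitsValue_le (by simpa using hl) h
  | succ j ih =>
    cases w with
    | nil => simp at hlt
    | cons d w =>
      cases w' with
      | nil => simp at hlt'
      | cons d' w' =>
        simp only [List.take_succ_cons, List.cons.injEq] at hj
        have hl' : w.length = w'.length := by simpa using hl
        obtain ⟨rfl, hj⟩ := hj
        rw [digitsValue, digitsValue, hl'] at h
        exact ih hl' hj _ _ (by omega)

theorem numValue_injective {b m : ℕ} : Function.Injective (numValue (b := b) (m := m)) := by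
  intro x y h
  rw [← digitsValue_ofFn, ← digitsValue_ofFn] at h
  exact List.ofFn_injective (digitsValue_injective (by simp) h)

theorem List.getElem?_flatten_of_length {α : Type*} {l : ℕ} (L : List (List α))
    (hL : ∀ u ∈ L, u.length = l) (i j : ℕ) (hj : j < l) :
    L.flatten[i * l + j]? = L[i]?.bind fun u => u[j]? := by
  induction L generalizing i with
  | nil => simp
  | cons u L ih =>
    have hu : u.length = l := hL u (by simp)
    rw [List.flatten_cons]
    cases i with
    | zero => rw [List.getElem?_append_left (by omega)]; simp
    | succ i =>
      rw [List.getElem?_append_right (by rw [hu, add_mul]; omega),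
        show (i + 1) * l + j - u.length = i * l + j by rw [hu, add_mul]; omega,
        ih (fun v hv => hL v (by simp [hv]))]
      simp

theorem getElem?_encodeNumbers {b n m : ℕ} (x : Fin n → Fin m → Fin b) (i j : ℕ)
    (hj : j < m + 1) :
    (encodeNumbers x)[i * (m + 1) + j]? =
      if h : i < n then ((List.ofFn fun j => Sum.inl (x ⟨i, h⟩ j)) ++ [Sum.inr ()])[j]?
      else none := by
  rw [encodeNumbers, List.getElem?_flatten_of_length _ _ _ _ hj]
  · by_cases h : i < n
    · simp [h]
    · simp [h]
  · simp

theorem sortNumbers_mono {b n m : ℕ} (x : Fin n → Fin m → Fin b) :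
    Monotone fun i => numValue (sortNumbers x i) :=
  Tuple.monotone_sort fun i => numValue (x i)

/-! ### The hard inputs and the lower bound -/

/-- `n - k` copies of the number `a`, followed by the `k` numbers `y`. -/
def padFront {V : Type} (n k : ℕ) (hk : k ≤ n) (a : V) (y : Fin k → V) (i : Fin n) : V :=
  if h : (i : ℕ) < n - k then a else y ⟨i - (n - k), by omega⟩

/-- When the first `n - k` of `n` numbers are maximal, then each of the other `k` numbers
is among the first `k` numbers in sorted order. -/
theorem exists_sortNumbers_padFront_eq {b n m k : ℕ} (hk : k ≤ n) {a : Fin m → Fin b}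
    (ha : ∀ v : Fin m → Fin b, numValue v ≤ numValue a) (y : Fin k → Fin m → Fin b) (j : Fin k) :
    ∃ i : Fin k, y j = sortNumbers (padFront n k hk a y) (i.castLE hk) := by
  set x := padFront n k hk a y with hx
  set σ := Tuple.sort fun i => numValue (x i) with hσ
  have hsort : ∀ i, sortNumbers x i = x (σ i) := fun i => rfl
  let e : Fin k → Fin n := fun j => ⟨n - k + j, by omega⟩
  have he : ∀ j, x (e j) = y j := by
    intro j
    simp [hx, padFront, e]
  -- If one of the first `k` sorted places holds a padding entry, every later place holds the
  -- maximal number too, so a number sorted beyond place `k` equals the entry found there.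
  by_cases hall : ∃ i : Fin k, (σ (i.castLE hk) : ℕ) < n - k
  · obtain ⟨i, hi⟩ := hall
    have hxi : x (σ (i.castLE hk)) = a := by simp [hx, padFront, hi]
    by_cases hpos : (σ.symm (e j) : ℕ) < k
    · exact ⟨⟨_, hpos⟩, by rw [hsort]; simp [he]⟩
    · refine ⟨i, ?_⟩
      rw [hsort, hxi]
      refine numValue_injective (le_antisymm (ha _) ?_)
      have hle : i.castLE hk ≤ σ.symm (e j) := by
        rw [Fin.le_def, Fin.val_castLE]; omega
      have := sortNumbers_mono x hle
      simpa [hsort, hxi, he] using this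
  · push Not at hall
    -- Otherwise the first `k` places hold only entries of `y`, and by counting all of them.
    let f : Fin k → Fin k := fun i => ⟨σ (i.castLE hk) - (n - k), by
      have := (σ (i.castLE hk)).isLt
      have := i.isLt
      omega⟩
    have hf : Function.Injective f := by
      intro i i' h
      have h1 := hall i
      have h2 := hall i'
      simp only [f, Fin.mk.injEq] at h
      have : σ (i.castLE hk) = σ (i'.castLE hk) := Fin.ext (by omega)
      simpa using this
    obtain ⟨i, hi⟩ := (Finite.injective_iff_surjective.1 hf) j
    refine ⟨i, ?_⟩
    rw [hsort, ← he, ← hi]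
    congr 1
    ext
    have := hall i
    simp [e, f]
    omega

namespace DARM

theorem SortsInSteps.out_run {b n m : ℕ} {M : DARM (Fin b ⊕ Unit)} {x : Fin n → Fin m → Fin b}
    {t T : ℕ} (h : M.SortsInSteps x t) (hT : t ≤ T) :
    (M.run (encodeNumbers x) T).out = (encodeNumbers (sortNumbers x)).map M.incl := by
  rw [M.run_eq_of_status_ne (t := t) _ hT]
  · exact h.2.2
  · rcases h.2.1 with h | h <;> simp [h]

/-- The counting bound: the outputs on `n - k` maximal numbers followed by `k` arbitrary numbers. -/
theorem exists_pow_le_of_sorts {b : ℕ} (hb : 1 ≤ b) (M : DARM (Fin b ⊕ Unit)) :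
    ∃ K : ℕ, 2 ≤ K ∧ ∀ n m k T : ℕ, 2 * k ≤ n →
      (∀ x : Fin n → Fin m → Fin b, ∃ t ≤ T, M.SortsInSteps x t) →
      (b ^ m) ^ k ≤ K ^ T * k ^ k := by
  obtain ⟨K, hK, hcard⟩ := M.exists_card_leftPart_le
  refine ⟨K, hK, fun n m k T hkn hT => ?_⟩
  have hk : k ≤ n := by omega
  let a : Fin m → Fin b := fun _ => ⟨b - 1, by omega⟩
  have ha : ∀ v : Fin m → Fin b, numValue v ≤ numValue a := fun v =>
    Finset.sum_le_sum fun j _ => Nat.mul_le_mul_right _ (by simp only [a]; omega)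
  let x : (Fin k → Fin m → Fin b) → Fin n → Fin m → Fin b := padFront n k hk a
  -- The cut after the padding: the inputs agree before it, and because `2 * k ≤ n` it leaves the
  -- first `k` numbers of the output on its left.
  set p := (n - k) * (m + 1) with hp
  have htake : ∀ y y', (encodeNumbers (x y)).take p = (encodeNumbers (x y')).take p := by
    intro y y'
    refine List.ext_getElem? fun q => ?_
    by_cases hq : q < p
    · rw [List.getElem?_take_of_lt hq, List.getElem?_take_of_lt hq, ← Nat.div_add_mod' q (m + 1)]
      have hi : q / (m + 1) < n - k := Nat.div_lt_of_lt_mul (by rwa [mul_comm, ← hp])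
      rw [getElem?_encodeNumbers _ _ _ (Nat.mod_lt _ (by omega)),
        getElem?_encodeNumbers _ _ _ (Nat.mod_lt _ (by omega))]
      simp [x, padFront, hi]
    · rw [List.getElem?_eq_none (by simp; omega), List.getElem?_eq_none (by simp; omega)]
  have hc := hcard p (fun y => encodeNumbers (x y)) htake T
  set R := Set.range fun y => M.leftPart p (M.run (encodeNumbers (x y)) T) with hR
  choose g hg using exists_sortNumbers_padFront_eq hk ha
  -- The left part of the final configuration shows the first `k` sorted numbers, and `g y` tells
  -- which of them is which entry of `y`.
  let F : (Fin k → Fin m → Fin b) → R × (Fin k → Fin k) := fun y =>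
    (⟨_, ⟨y, rfl⟩⟩, g y)
  have hF : Function.Injective F := by
    intro y y' h
    obtain ⟨h1, h2⟩ := Prod.mk.inj h
    have h3 := ((M.leftPart_eq_iff).1 (Subtype.ext_iff.1 h1)).2.2.1
    obtain ⟨t, ht, hs⟩ := hT (x y)
    obtain ⟨t', ht', hs'⟩ := hT (x y')
    rw [hs.out_run ht, hs'.out_run ht', ← List.map_take, ← List.map_take] at h3
    have h4 := List.map_injective_iff.2 M.incl.injective h3
    funext j
    rw [hg y j, hg y' j, ← h2]
    funext l
    have hi : (g y j : ℕ) * (m + 1) + l < p := by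
      have h5 : ((g y j : ℕ) + 1) * (m + 1) ≤ p := Nat.mul_le_mul_right _ (by omega)
      rw [add_mul] at h5
      omega
    have h5 := congrArg (fun u => u[(g y j : ℕ) * (m + 1) + l]?) h4
    rw [List.getElem?_take_of_lt hi, List.getElem?_take_of_lt hi,
      getElem?_encodeNumbers _ _ _ (by omega), getElem?_encodeNumbers _ _ _ (by omega)] at h5
    have h6 : (g y j : ℕ) < n := by omega
    simp only [h6, dif_pos] at h5
    rw [List.getElem?_append_left (by simp), List.getElem?_append_left (by simp)] at h5
    change sortNumbers (x y) ⟨g y j, h6⟩ l = sortNumbers (x y') ⟨g y j, h6⟩ l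
    simpa using h5
  have : Finite R := Set.finite_range _
  have := Nat.card_le_card_of_injective F hF
  rw [Nat.card_prod] at this
  simp only [Nat.card_eq_fintype_card, Fintype.card_fun, Fintype.card_fin] at this
  refine this.trans (Nat.mul_le_mul_right _ ?_)
  exact hc

end DARM

/-- Logarithms turn the counting bound into `k * m * log b ≤ T * log K + k * log n`. The assumption
on `m` bounds the last term by a fraction `1 / (1 + ε)` of the left side, so `T * log K` is at least
the fraction `ε / (1 + ε)` of it. -/
theorem DARM.exists_le_steps_of_sorts {b : ℕ} (hb : 2 ≤ b) (M : DARM (Fin b ⊕ Unit))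
    (hM : ∀ n m : ℕ, 1 ≤ n → 1 ≤ m → ∀ x : Fin n → Fin m → Fin b, ∃ t : ℕ, M.SortsInSteps x t)
    (ε : ℝ) (hε : 0 < ε) :
    ∃ c : ℝ, 0 < c ∧ ∀ n m : ℕ, 2 ≤ n → (1 + ε) * Real.logb b n ≤ m →
      ∃ (x : Fin n → Fin m → Fin b) (t : ℕ),
        M.SortsInSteps x t ∧ c * ((n : ℝ) * (m : ℝ)) ≤ (t : ℝ) := by
  obtain ⟨K, hK, h⟩ := M.exists_pow_le_of_sorts (by omega : 1 ≤ b)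
  have hlb : 0 < Real.log b := Real.log_pos (by exact_mod_cast hb)
  have hlK : 0 < Real.log K := Real.log_pos (by exact_mod_cast hK)
  -- Of the 6, a factor 3 comes from `n ≤ 3 * (n / 2)`, and a factor 2 makes the final contradiction
  -- strict.
  refine ⟨Real.log b * ε / (6 * (1 + ε) * Real.log K), by positivity, fun n m hn hm => ?_⟩
  set c := Real.log b * ε / (6 * (1 + ε) * Real.log K) with hc
  have hcK : 6 * (1 + ε) * (c * Real.log K) = Real.log b * ε := by
    rw [hc]; field_simp
  have hn' : (1 : ℝ) < n := by exact_mod_cast hn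
  have hln : 0 < Real.log n := Real.log_pos hn'
  have hm' : (1 + ε) * Real.log n ≤ m * Real.log b := by
    rwa [Real.logb, ← mul_div_assoc, div_le_iff₀ hlb] at hm
  have hmpos : (0 : ℝ) < m := by
    by_contra hneg
    have : (m : ℝ) * Real.log b ≤ 0 := mul_nonpos_of_nonpos_of_nonneg (by linarith) hlb.le
    have : 0 < (1 + ε) * Real.log n := by positivity
    linarith
  have hm1 : 1 ≤ m := by exact_mod_cast hmpos
  by_contra hcon
  push Not at hcon
  set T := ⌊c * (n * m : ℝ)⌋₊ with hT
  have hTle : (T : ℝ) ≤ c * (n * m) := Nat.floor_le (by positivity)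
  have hk := h n m (n / 2) T (by omega) fun x => by
    obtain ⟨t, ht⟩ := hM n m (by omega) hm1 x
    exact ⟨t, Nat.le_floor (hcon x t ht).le, ht⟩
  have hk1 : 1 ≤ n / 2 := by omega
  have hkn : n ≤ 3 * (n / 2) := by omega
  have hkle : n / 2 ≤ n := by omega
  generalize n / 2 = k at *
  have hk1' : (1 : ℝ) ≤ k := by exact_mod_cast hk1
  have hkn' : (n : ℝ) ≤ 3 * k := by exact_mod_cast hkn
  have hkr : ((b : ℝ) ^ m) ^ k ≤ (K : ℝ) ^ T * (n : ℝ) ^ k := by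
    calc ((b : ℝ) ^ m) ^ k ≤ (K : ℝ) ^ T * (k : ℝ) ^ k := by exact_mod_cast hk
      _ ≤ _ := by gcongr
  have hlog := Real.log_le_log (by positivity) hkr
  rw [Real.log_mul (by positivity) (by positivity), Real.log_pow, Real.log_pow, Real.log_pow,
    Real.log_pow] at hlog
  have h1 : (k : ℝ) * ((1 + ε) * Real.log n) ≤ k * (m * Real.log b) := by gcongr
  have h2 : (T : ℝ) * Real.log K ≤ c * (n * m) * Real.log K := by gcongr
  have h3 : (1 + ε) * (k * (m * Real.log b)) ≤ (1 + ε) * (T * Real.log K + k * Real.log n) := by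
    gcongr
  have h4 : (1 + ε) * (T * Real.log K) ≤ (1 + ε) * (c * (n * m) * Real.log K) := by gcongr
  have h5 : ε * Real.log b * (n * m) ≤ ε * Real.log b * (3 * k * m) := by gcongr
  have h6 : 0 < ε * Real.log b * (k * m) := by positivity
  have h7 : 6 * ((1 + ε) * (c * (n * m) * Real.log K)) = ε * Real.log b * (n * m) := by
    linear_combination (n * m : ℝ) * hcK
  nlinarith

/-! ### Criteria for automaticity -/

/-- `c` is a convolution of strings of which those in `E` are empty. -/
def ValidConvolution {A : Type} {k : ℕ} : Set (Fin k) → List (Fin k → Option A) → Prop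
  | _, [] => True
  | E, a :: c => ((∃ i, a i ≠ none) ∧ ∀ i ∈ E, a i = none) ∧ ValidConvolution {i | a i = none} c

theorem convolution_eq_nil {A : Type} {k : ℕ} {w : Fin k → List A} (h : ∀ i, w i = []) :
    convolution w = [] := by
  rw [← List.length_eq_zero_iff, length_convolution]
  simp [h]

theorem convolution_eq_cons {A : Type} {k : ℕ} {w : Fin k → List A} (h : ∃ i, w i ≠ []) :
    convolution w = (fun i => (w i)[0]?) :: convolution fun i => (w i).tail := by
  obtain ⟨i, hi⟩ := h
  have hpos := List.length_pos_iff.2 hi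
  have hlen : (convolution w).length = (convolution fun i => (w i).tail).length + 1 := by
    simp only [length_convolution, List.length_tail]
    have : Nonempty (Fin k) := ⟨i⟩
    refine le_antisymm (Finset.sup_le fun j _ => ?_) ?_
    · have := Finset.le_sup (f := fun i => (w i).length - 1) (Finset.mem_univ j)
      omega
    · obtain ⟨j, -, hj⟩ := Finset.exists_mem_eq_sup Finset.univ Finset.univ_nonempty
        fun i => (w i).length - 1
      rw [hj]
      have h1 := Finset.le_sup (f := fun i => (w i).length) (Finset.mem_univ j)
      have h2 := Finset.le_sup (f := fun i => (w i).length) (Finset.mem_univ i)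
      omega
  refine List.ext_getElem (by simpa using hlen) fun j h1 h2 => ?_
  cases j with
  | zero => simp [convolution]
  | succ j => simp [convolution]

theorem validConvolution_convolution {A : Type} {k : ℕ} (w : Fin k → List A) (E : Set (Fin k))
    (hE : ∀ i ∈ E, w i = []) : ValidConvolution E (convolution w) := by
  induction hn : (convolution w).length generalizing w E with
  | zero => rw [List.length_eq_zero_iff.1 hn]; trivial
  | succ n ih =>
    by_cases h : ∃ i, w i ≠ []
    · rw [convolution_eq_cons h] at hn ⊢
      refine ⟨⟨?_, ?_⟩, ih _ _ ?_ (by simpa using hn)⟩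
      · obtain ⟨i, hi⟩ := h
        exact ⟨i, by simpa using hi⟩
      · intro i hi
        simp [hE i hi]
      · intro i hi
        have hi' : w i = [] := by simpa using hi
        simp [hi']
    · push Not at h
      simp [convolution_eq_nil h] at hn

theorem ValidConvolution.exists_convolution_eq {A : Type} {k : ℕ} {c : List (Fin k → Option A)}
    {E : Set (Fin k)} (h : ValidConvolution E c) :
    ∃ w, convolution w = c ∧ ∀ i ∈ E, w i = [] := by
  induction c generalizing E with
  | nil => exact ⟨fun _ => [], convolution_eq_nil fun _ => rfl, fun _ _ => rfl⟩
  | cons a c ih =>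
    obtain ⟨⟨⟨i, hi⟩, h2⟩, h3⟩ := h
    obtain ⟨w, hw, hw'⟩ := ih h3
    have key : ∀ i, ((a i).toList ++ w i)[0]? = a i ∧ ((a i).toList ++ w i).tail = w i := by
      intro i
      cases h : a i with
      | none => simp [hw' i h]
      | some s => simp
    refine ⟨fun i => (a i).toList ++ w i, ?_, fun i hiE => ?_⟩
    · rw [convolution_eq_cons ⟨i, by simp [hi]⟩]
      simp only [key, hw]
    · simp [h2 i hiE, hw' i (h2 i hiE)]

open Classical in
/-- The transition function of an automaton that checks `ValidConvolution`. -/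
noncomputable def validStep {A : Type} {k : ℕ} :
    Option (Set (Fin k)) → (Fin k → Option A) → Option (Set (Fin k))
  | none, _ => none
  | some E, a => if (∃ i, a i ≠ none) ∧ ∀ i ∈ E, a i = none then some {i | a i = none} else none

theorem foldl_validStep_none {A : Type} {k : ℕ} (c : List (Fin k → Option A)) :
    c.foldl validStep none = none := by
  induction c with
  | nil => rfl
  | cons a c ih => exact ih

theorem foldl_validStep_ne_none {A : Type} {k : ℕ} (c : List (Fin k → Option A))
    (E : Set (Fin k)) : c.foldl validStep (some E) ≠ none ↔ ValidConvolution E c := by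
  induction c generalizing E with
  | nil => simp [ValidConvolution]
  | cons a c ih =>
    rw [List.foldl_cons, validStep, ValidConvolution]
    split_ifs with h
    · rw [ih]; simp only [h, true_and]
      tauto
    · rw [foldl_validStep_none]
      tauto

/-- A relation is automatic when membership is decided by a finite automaton that reads
convolutions; its behaviour on other strings is irrelevant. -/
theorem IsAutomaticRel.of_foldl {A σ : Type} [Finite σ] {k : ℕ} {R : Set (Fin k → List A)}
    (δ : σ → (Fin k → Option A) → σ) (q : σ) (acc : Set σ)
    (h : ∀ w, (convolution w).foldl δ q ∈ acc ↔ w ∈ R) : IsAutomaticRel R := by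
  have := Fintype.ofFinite (σ × Option (Set (Fin k)))
  -- The given automaton runs in parallel with one that rejects everything but convolutions.
  let D : DFA (Fin k → Option A) (σ × Option (Set (Fin k))) :=
    ⟨fun s a => (δ s.1 a, validStep s.2 a), (q, some ∅), {s | s.1 ∈ acc ∧ s.2 ≠ none}⟩
  have hD : ∀ (c : List (Fin k → Option A)) s,
      D.evalFrom s c = (c.foldl δ s.1, c.foldl validStep s.2) := by
    intro c
    induction c with
    | nil => intro s; rfl
    | cons a c ih => intro s; exact ih _
  refine ⟨_, this, D, ?_⟩
  ext c
  rw [DFA.mem_accepts, DFA.eval, hD]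
  change (c.foldl δ q ∈ acc ∧ c.foldl validStep (some ∅) ≠ none) ↔ c ∈ convolution '' R
  rw [foldl_validStep_ne_none]
  constructor
  · rintro ⟨h1, h2⟩
    obtain ⟨w, rfl, -⟩ := h2.exists_convolution_eq
    exact ⟨w, (h w).1 h1, rfl⟩
  · rintro ⟨w, hw, rfl⟩
    exact ⟨(h w).2 hw, validConvolution_convolution w ∅ (by simp)⟩

/-- A predicate of one string is automatic when it is decided by a finite automaton. -/
theorem isAutomaticRel_of_foldl_unary {A σ : Type} [Finite σ] (δ : σ → A → σ) (q : σ)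
    (acc : Set σ) : IsAutomaticRel {w : Fin 1 → List A | (w 0).foldl δ q ∈ acc} := by
  refine IsAutomaticRel.of_foldl (fun s c => ((c 0).map (δ s)).getD s) q acc fun w => ?_
  rw [Set.mem_ofPred_eq]
  suffices h : ∀ (u : List A) (w : Fin 1 → List A), w 0 = u → ∀ q,
      (convolution w).foldl (fun s c => ((c 0).map (δ s)).getD s) q = u.foldl δ q by
    rw [h _ w rfl]
  intro u
  induction u with
  | nil =>
    intro w hw q
    rw [convolution_eq_nil fun i => by rw [Subsingleton.elim i 0, hw]]
    rfl
  | cons a u ih =>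
    intro w hw q
    rw [convolution_eq_cons ⟨0, by simp [hw]⟩, List.foldl_cons, ih _ (by simp [hw])]
    simp [hw]

/-- The letterwise transformation of a string in which the new letter depends on a left state, which
summarizes the letters before it, and on a right state, which summarizes the letters after it. -/
def contextMap {A L R : Type} (o : L → A → R → A) (δL : L → A → L) (δR : A → R → R) (r : R) :
    L → List A → List A
  | _, [] => []
  | q, a :: l => o q a (l.foldr δR r) :: contextMap o δL δR r (δL q a) l

/-- A unary function is automatic when it is a `contextMap` whose output function depends also on
finite information about the whole string. -/
theorem isAutomaticFun_contextMap {A G L R : Type} [Finite G] [Finite L] [Finite R]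
    (γ : G → A → G) (g : G) (o : G → L → A → R → A) (δL : L → A → L) (δR : A → R → R) (r : R)
    (q : L) : IsAutomaticFun fun w : Fin 1 → List A =>
      contextMap (o ((w 0).foldl γ g)) δL δR r q (w 0) := by
  -- A subset construction. The set holds the guesses, for the final value of `γ` and for the right
  -- state of the unread letters, under which all output letters so far are correct. Output beyond
  -- the end of the input empties it.
  let δ : G × L × Set (G × R) → (Fin 2 → Option A) → G × L × Set (G × R) := fun s c =>
    match c 0 with
    | some a => (γ s.1 a, δL s.2.1 a,
        {z | (z.1, δR a z.2) ∈ s.2.2 ∧ c 1 = some (o z.1 s.2.1 a z.2)})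
    | none => (s.1, s.2.1, ∅)
  have key : ∀ (u v : List A) (w : Fin 2 → List A), w 0 = u → w 1 = v → ∀ s,
      ((convolution w).foldl δ s).1 = u.foldl γ s.1 ∧
      ∀ x, (x, r) ∈ ((convolution w).foldl δ s).2.2 ↔
        (x, u.foldr δR r) ∈ s.2.2 ∧ v = contextMap (o x) δL δR r s.2.1 u := by
    have none_case : ∀ (v : List A) (w : Fin 2 → List A), w 0 = [] → w 1 = v →
        ∀ s, ((convolution w).foldl δ s).1 = s.1 ∧
          (s.2.2 = ∅ ∨ v ≠ [] → ((convolution w).foldl δ s).2.2 = ∅) := by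
      intro v
      induction v with
      | nil =>
        intro w h0 h1 s
        rw [convolution_eq_nil (Fin.forall_fin_two.2 ⟨h0, h1⟩)]
        exact ⟨rfl, by simp⟩
      | cons a v ih =>
        intro w h0 h1 s
        rw [convolution_eq_cons ⟨1, by simp [h1]⟩, List.foldl_cons]
        have hs : δ s (fun i => (w i)[0]?) = (s.1, s.2.1, ∅) := by simp [δ, h0]
        rw [hs]
        have := ih (fun i => (w i).tail) (by simp [h0]) (by simp [h1]) (s.1, s.2.1, ∅)
        exact ⟨this.1, fun _ => this.2 (Or.inl rfl)⟩
    intro u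
    induction u with
    | nil =>
      intro v w h0 h1 s
      have h := none_case v w h0 h1 s
      refine ⟨h.1, fun x => ?_⟩
      by_cases hv : v = []
      · rw [convolution_eq_nil (Fin.forall_fin_two.2 ⟨h0, by rw [h1, hv]⟩)]
        simp [hv, contextMap]
      · rw [h.2 (Or.inr hv)]
        simp [hv, contextMap]
    | cons a u ih =>
      intro v w h0 h1 s
      rw [convolution_eq_cons ⟨0, by simp [h0]⟩, List.foldl_cons]
      have hs : δ s (fun i => (w i)[0]?) = (γ s.1 a, δL s.2.1 a,
          {z | (z.1, δR a z.2) ∈ s.2.2 ∧ v[0]? = some (o z.1 s.2.1 a z.2)}) := by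
        simp [δ, h0, h1]
      rw [hs]
      obtain ⟨h2, h3⟩ := ih v.tail (fun i => (w i).tail) (by simp [h0]) (by simp [h1])
        (γ s.1 a, δL s.2.1 a,
          {z | (z.1, δR a z.2) ∈ s.2.2 ∧ v[0]? = some (o z.1 s.2.1 a z.2)})
      refine ⟨h2, fun x => ?_⟩
      rw [h3]
      cases v with
      | nil => simp [contextMap]
      | cons a' v =>
        simp [contextMap, and_assoc]
  refine IsAutomaticRel.of_foldl δ (g, q, Set.univ) {s | (s.1, r) ∈ s.2.2} fun w => ?_
  obtain ⟨h1, h2⟩ := key _ _ w rfl rfl (g, q, Set.univ)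
  rw [Set.mem_ofPred_eq, h2, h1]
  simp [Fin.init]

/-- A unary function with finitely many values is automatic when its value is computed by a finite
automaton. -/
theorem isAutomaticFun_const_of_foldl {A G : Type} [Finite G] [Finite A] (γ : G → A → G) (g : G)
    (h : G → Option A) :
    IsAutomaticFun fun w : Fin 1 → List A => (h ((w 0).foldl γ g)).toList := by
  -- The state consists of the run of `γ`, the first symbol on the output track (`none` before
  -- anything is read, `some none` for padding), and whether that track is free of letters after the
  -- first position.
  let δ : G × Option (Option A) × Bool → (Fin 2 → Option A) → G × Option (Option A) × Bool :=
    fun s c => (((c 0).map (γ s.1)).getD s.1, some (s.2.1.getD (c 1)),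
      s.2.2 && (s.2.1.isNone || (c 1).isNone))
  have key : ∀ (n : ℕ) (u v : List A) (w : Fin 2 → List A), u.length + v.length = n →
      w 0 = u → w 1 = v → ∀ s,
      ((convolution w).foldl δ s).1 = u.foldl γ s.1 ∧
      (∀ y, s.2.1 = some y → ((convolution w).foldl δ s).2.1 = some y ∧
        (((convolution w).foldl δ s).2.2 = true ↔ s.2.2 = true ∧ v = [])) ∧
      (s.2.1 = none → (((convolution w).foldl δ s).2.1.getD none) = v[0]? ∧
        (((convolution w).foldl δ s).2.2 = true ↔ s.2.2 = true ∧ v.tail = [])) := by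
    intro n
    induction n using Nat.strong_induction_on with
    | _ n ih =>
    intro u v w hn h0 h1 s
    by_cases hnil : u = [] ∧ v = []
    · obtain ⟨rfl, rfl⟩ := hnil
      rw [convolution_eq_nil (Fin.forall_fin_two.2 ⟨h0, h1⟩)]
      simp +contextual
    · have hex : ∃ i, w i ≠ [] := by
        by_contra hc
        push Not at hc
        exact hnil ⟨h0 ▸ hc 0, h1 ▸ hc 1⟩
      rw [convolution_eq_cons hex, List.foldl_cons]
      have hlt : u.tail.length + v.tail.length < n := by
        rcases not_and_or.1 hnil with h | h <;> have := List.length_pos_iff.2 h <;>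
          simp only [List.length_tail] <;> omega
      obtain ⟨i1, i2, -⟩ := ih _ hlt u.tail v.tail (fun i => (w i).tail) rfl (by simp [h0])
        (by simp [h1]) (δ s fun i => (w i)[0]?)
      refine ⟨?_, ?_, ?_⟩
      · rw [i1]
        cases u <;> simp [δ, h0]
      · intro y hy
        obtain ⟨j1, j2⟩ := i2 y (by simp [δ, hy])
        refine ⟨j1, ?_⟩
        rw [j2]
        cases v <;> simp [δ, hy, h1]
      · intro hy
        obtain ⟨j1, j2⟩ := i2 v[0]? (by simp [δ, hy, h1])
        refine ⟨by rw [j1]; rfl, ?_⟩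
        rw [j2]
        simp [δ, hy]
  refine IsAutomaticRel.of_foldl δ (g, none, true)
    {s | s.2.2 = true ∧ s.2.1.getD none = h s.1} fun w => ?_
  obtain ⟨h1, -, h2⟩ := key _ _ _ w rfl rfl rfl (g, none, true)
  obtain ⟨h2, h3⟩ := h2 rfl
  rw [Set.mem_ofPred_eq, h1, h2, h3]
  change _ ↔ w 1 = (h ((w 0).foldl γ g)).toList
  cases h ((w 0).foldl γ g) with
  | none =>
    cases w 1 <;> simp
  | some a =>
    cases w 1 <;> simp
    tauto

/-- This permits analysing a pass block by block: each part sees the other only through a left or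
right state. -/
theorem contextMap_append {A L R : Type} (o : L → A → R → A) (δL : L → A → L) (δR : A → R → R)
    (r : R) (q : L) (u l : List A) :
    contextMap o δL δR r q (u ++ l) =
      contextMap o δL δR (l.foldr δR r) q u ++ contextMap o δL δR r (u.foldl δL q) l := by
  induction u generalizing q with
  | nil => rfl
  | cons a u ih => simp [contextMap, ih]

/-! ### One pass of the parallel selection sort -/

namespace SelectionSort

/-- A letter is a symbol with an annotation: `none` means that the letter is deleted, `some true`
that it is marked, `some false` that it is present and not marked. -/
abbrev Letter (b : ℕ) : Type := (Fin b ⊕ Unit) × Option Bool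

variable {b : ℕ}

/-- The digits come first, in their order, and then the separator. -/
def symbolRank : Fin b ⊕ Unit → ℕ
  | .inl d => d
  | .inr _ => b

theorem symbolRank_injective : Function.Injective (symbolRank (b := b)) := by
  rintro (d | _) (d' | _) h <;> simp only [symbolRank] at h
  · rw [Fin.ext h]
  · omega
  · omega
  · rfl

open Classical in
/-- The least symbol of a set, if the set is nonempty. -/
noncomputable def minSymbol (E : Set (Fin b ⊕ Unit)) : Option (Fin b ⊕ Unit) :=
  if h : ∃ s ∈ E, ∀ s' ∈ E, symbolRank s ≤ symbolRank s' then some h.choose else none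

theorem minSymbol_empty : minSymbol (∅ : Set (Fin b ⊕ Unit)) = none := by
  simp [minSymbol]

theorem minSymbol_eq_some {E : Set (Fin b ⊕ Unit)} {s : Fin b ⊕ Unit} (hs : s ∈ E)
    (h : ∀ s' ∈ E, symbolRank s ≤ symbolRank s') : minSymbol E = some s := by
  have hex : ∃ s ∈ E, ∀ s' ∈ E, symbolRank s ≤ symbolRank s' := ⟨s, hs, h⟩
  rw [minSymbol, dif_pos hex]
  obtain ⟨h1, h2⟩ := hex.choose_spec
  exact congrArg some (symbolRank_injective (le_antisymm (h2 s hs) (h _ h1)))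

open Classical in
/-- Collects the marked symbols. -/
noncomputable def collectMarked (E : Set (Fin b ⊕ Unit)) (a : Letter b) : Set (Fin b ⊕ Unit) :=
  if a.2 = some true then insert a.1 E else E

theorem foldl_collectMarked (v : List (Letter b)) (E : Set (Fin b ⊕ Unit)) :
    v.foldl collectMarked E = E ∪ {s | (s, some true) ∈ v} := by
  induction v generalizing E with
  | nil => simp
  | cons a v ih =>
    obtain ⟨s, t⟩ := a
    rw [List.foldl_cons, ih]
    ext s'
    by_cases ht : t = some true
    · simp [collectMarked, ht]
      tauto
    · simp [collectMarked, ht, Ne.symm ht]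

/-- The least marked symbol. -/
noncomputable def leastMarked (v : List (Letter b)) : Option (Fin b ⊕ Unit) :=
  minSymbol (v.foldl collectMarked ∅)

/-- The left state: the previous letter, and whether a marked separator has occurred. -/
def leftStep (q : Option (Letter b) × Bool) (a : Letter b) : Option (Letter b) × Bool :=
  (some a, q.2 || decide (a = (Sum.inr (), some true)))

/-- The right state: whether the next separator is marked. -/
def rightStep (a : Letter b) (r : Bool) : Bool :=
  match a.1 with
  | .inl _ => r
  | .inr _ => decide (a.2 = some true)

/-- Whether the letter before the current one, if any, is a separator. -/
def atStart : Option (Letter b) → Bool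
  | some (.inl _, _) => false
  | _ => true

/-- The new letter, depending on the least marked symbol. If there are no marks, then the first
letter of each block is marked. If the least marked symbol is a digit, then the marks at this
digit move on by one letter, and the others are removed. If separators are marked, then the
block of the first marked separator is deleted, and all marks are removed. -/
def newLetter (g : Option (Fin b ⊕ Unit)) (q : Option (Letter b) × Bool) (a : Letter b)
    (r : Bool) : Letter b :=
  match a.2, g with
  | none, _ => a
  | some _, none => (a.1, some (atStart q.1))
  | some _, some (.inl d) => (a.1, some (decide (q.1 = some (Sum.inl d, some true))))
  | some _, some (.inr _) => (a.1, if rightStep a r && !q.2 then none else some false)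

/-- One pass over the stored string, as described at `newLetter`. -/
noncomputable def pass (v : List (Letter b)) : List (Letter b) :=
  contextMap (newLetter (leastMarked v)) leftStep rightStep false (none, false) v

/-- The least marked symbol as a string of at most one letter. -/
noncomputable def output (v : List (Letter b)) : List (Letter b) :=
  ((leastMarked v).map fun s => (s, some false)).toList

/-- Some letter is not deleted. -/
def IsAlive (v : List (Letter b)) : Prop := ∃ a ∈ v, a.2 ≠ none

noncomputable def passFun (b : ℕ) : AutomaticFun (Letter b) 1 where
  toFun w := pass (w 0)
  automatic := isAutomaticFun_contextMap collectMarked ∅ (fun E => newLetter (minSymbol E))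
    leftStep rightStep false (none, false)

noncomputable def outputFun (b : ℕ) : AutomaticFun (Letter b) 1 where
  toFun w := output (w 0)
  automatic := isAutomaticFun_const_of_foldl collectMarked ∅
    fun E => (minSymbol E).map fun s => (s, some false)

theorem foldl_isSome (v : List (Letter b)) (q : Bool) :
    v.foldl (fun q a => q || a.2.isSome) q = true ↔ q = true ∨ IsAlive v := by
  induction v generalizing q with
  | nil => simp [IsAlive]
  | cons a v ih =>
    rw [List.foldl_cons, ih]
    simp [IsAlive, Option.isSome_iff_ne_none, or_assoc]

def alivePred (b : ℕ) : AutomaticPred (Letter b) 1 where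
  holds := {w | IsAlive (w 0)}
  automatic := by
    have h := isAutomaticRel_of_foldl_unary
      (fun (q : Bool) (a : Letter b) => q || a.2.isSome) false {true}
    simpa only [Set.mem_singleton_iff, foldl_isSome, Bool.false_eq_true, false_or] using h

/-! ### Blocks -/

/-- The annotation of the first letter of a block. The status of a block is `none` if it is deleted,
and otherwise tells the position of the mark in the block, if any. -/
def firstAnnotation : Option (Option ℕ) → Option Bool
  | none => none
  | some (some 0) => some true
  | some _ => some false

/-- The status of the block without its first letter. -/
def tailStatus : Option (Option ℕ) → Option (Option ℕ)
  | none => none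
  | some (some (k + 1)) => some (some k)
  | some _ => some none

/-- The block with digits `w` and a given status. -/
def block : List (Fin b) → Option (Option ℕ) → List (Letter b)
  | [], t => [(.inr (), firstAnnotation t)]
  | d :: w, t => (.inl d, firstAnnotation t) :: block w (tailStatus t)

theorem marked_mem_block {w : List (Fin b)} {t : Option (Option ℕ)} {s : Fin b ⊕ Unit} :
    (s, some true) ∈ block w t ↔
      ∃ k, t = some (some k) ∧ (w.map Sum.inl ++ [Sum.inr ()])[k]? = some s := by
  induction w generalizing t with
  | nil =>
    rcases t with _ | _ | _ | k <;> simp [block, firstAnnotation, eq_comm]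
  | cons d w ih =>
    rcases t with _ | _ | _ | k <;> simp [block, firstAnnotation, ih, tailStatus, eq_comm]

theorem exists_present_mem_block {w : List (Fin b)} {t : Option (Option ℕ)} :
    (∃ a ∈ block w t, a.2 ≠ none) ↔ t ≠ none := by
  induction w generalizing t with
  | nil =>
    rcases t with _ | _ | _ | k <;> simp [block, firstAnnotation]
  | cons d w ih =>
    simp only [block, List.exists_mem_cons_iff, ih]
    rcases t with _ | _ | _ | k <;> simp [firstAnnotation, tailStatus]

/-- All that a block reveals to later blocks: a new block starts, and whether a marked separator has
been seen. -/
theorem foldl_leftStep_block (w : List (Fin b)) (t : Option (Option ℕ))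
    (q : Option (Letter b) × Bool) :
    atStart ((block w t).foldl leftStep q).1 = true ∧
      ((block w t).foldl leftStep q).2 = (q.2 || decide (t = some (some w.length))) := by
  induction w generalizing t q with
  | nil =>
    rcases t with _ | _ | _ | k <;> simp [block, firstAnnotation, leftStep, atStart]
  | cons d w ih =>
    rw [block, List.foldl_cons]
    refine ⟨(ih _ _).1, ?_⟩
    rw [(ih _ _).2]
    rcases t with _ | _ | _ | k <;> simp [leftStep, tailStatus]

theorem foldr_rightStep_block (w : List (Fin b)) (t : Option (Option ℕ)) (r : Bool) :
    (block w t).foldr rightStep r = decide (t = some (some w.length)) := by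
  induction w generalizing t with
  | nil =>
    rcases t with _ | _ | _ | k <;> simp [block, firstAnnotation, rightStep]
  | cons d w ih =>
    rw [block, List.foldr_cons, ih]
    rcases t with _ | _ | _ | k <;> simp [rightStep, tailStatus]

theorem contextMap_none_block (w : List (Fin b)) (t : Option (Option ℕ))
    (q : Option (Letter b) × Bool) (r : Bool) :
    contextMap (newLetter none) leftStep rightStep r q (block w t) =
      block w (t.map fun _ => if atStart q.1 then some 0 else none) := by
  induction w generalizing t q with
  | nil =>
    rcases t with _ | _ | _ | k <;> by_cases h : atStart q.1 = true <;>
      simp [block, firstAnnotation, contextMap, newLetter, h]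
  | cons d w ih =>
    have hs : ∀ x, atStart (b := b) (some (.inl d, x)) = false := fun _ => rfl
    rw [block, contextMap, ih]
    rcases t with _ | _ | _ | k <;> by_cases h : atStart q.1 = true <;>
      simp [block, firstAnnotation, tailStatus, newLetter, leftStep, hs, h]

/-- Moves the mark of a block on if it is at the digit `d`, and otherwise removes it. -/
def advance (d : Fin b) (w : List (Fin b)) : Option ℕ → Option ℕ
  | none => none
  | some k => if w[k]? = some d then some (k + 1) else none

/-- The two claims need each other in the induction: a mark on the head at the digit `d` moves to
the first letter of the tail, which is then a block without a mark, preceded by a marked `d`. -/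
theorem contextMap_digit_block (d : Fin b) (w : List (Fin b)) (q : Option (Letter b) × Bool)
    (r : Bool) :
    (∀ t, q.1 ≠ some (Sum.inl d, some true) →
      contextMap (newLetter (some (.inl d))) leftStep rightStep r q (block w t) =
        block w (t.map (advance d w))) ∧
    (q.1 = some (Sum.inl d, some true) →
      contextMap (newLetter (some (.inl d))) leftStep rightStep r q (block w (some none)) =
        block w (some (some 0))) := by
  induction w generalizing q with
  | nil =>
    refine ⟨fun t hq => ?_, fun hq => ?_⟩
    · rcases t with _ | _ | _ | k <;>
        simp [block, firstAnnotation, contextMap, newLetter, advance, hq]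
    · simp [block, firstAnnotation, contextMap, newLetter, hq]
  | cons c w ih =>
    refine ⟨fun t hq => ?_, fun hq => ?_⟩
    · rw [block, contextMap]
      rcases t with _ | _ | _ | k
      · rw [(ih _).1 _ (by simp [leftStep, firstAnnotation])]
        simp [block, firstAnnotation, newLetter, tailStatus]
      · rw [(ih _).1 _ (by simp [leftStep, firstAnnotation])]
        simp [block, firstAnnotation, newLetter, tailStatus, advance, hq]
      · by_cases hc : c = d
        · rw [tailStatus, (ih _).2 (by simp [leftStep, firstAnnotation, hc])]
          · simp [block, firstAnnotation, newLetter, tailStatus, advance, hq, hc]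
          · simp
        · rw [(ih _).1 _ (by simp [leftStep, hc])]
          simp [block, firstAnnotation, newLetter, tailStatus, advance, hq, hc]
      · rw [(ih _).1 _ (by simp [leftStep, firstAnnotation])]
        by_cases hk : w[k]? = some d <;>
          simp [block, firstAnnotation, newLetter, tailStatus, advance, hq, hk]
    · rw [block, contextMap, (ih _).1 _ (by simp [leftStep, firstAnnotation])]
      simp [block, firstAnnotation, newLetter, tailStatus, advance, hq]

/-- `newLetter` consults `rightStep a r` rather than `r`, so a separator sees its own mark and the
block is deleted or kept as a whole. -/
theorem contextMap_separator_block (w : List (Fin b)) (t : Option (Option ℕ))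
    (q : Option (Letter b) × Bool) (r : Bool) :
    contextMap (newLetter (some (.inr ()))) leftStep rightStep r q (block w t) =
      block w (if decide (t = some (some w.length)) && !q.2 then none
        else t.map fun _ => none) := by
  induction w generalizing t q with
  | nil =>
    rcases t with _ | _ | _ | k <;> cases hq : q.2 <;>
      simp [block, firstAnnotation, contextMap, newLetter, rightStep, hq]
  | cons d w ih =>
    rw [block, contextMap, ih, foldr_rightStep_block]
    rcases t with _ | _ | _ | k <;> cases hq : q.2 <;>
      simp [block, firstAnnotation, tailStatus, newLetter, leftStep, rightStep, hq]
    split_ifs <;> simp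

/-- The string of a list of blocks. -/
def blocks (B : List (List (Fin b) × Option (Option ℕ))) : List (Letter b) :=
  B.flatMap fun u => block u.1 u.2

theorem contextMap_none_blocks (B : List (List (Fin b) × Option (Option ℕ)))
    (q : Option (Letter b) × Bool) (hq : atStart q.1 = true) :
    contextMap (newLetter none) leftStep rightStep false q (blocks B) =
      blocks (B.map fun u => (u.1, u.2.map fun _ => some 0)) := by
  induction B generalizing q with
  | nil => rfl
  | cons u B ih =>
    rw [blocks, List.flatMap_cons, contextMap_append, contextMap_none_block, ← blocks,
      ih _ (foldl_leftStep_block _ _ _).1, if_pos hq]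
    rfl

theorem contextMap_digit_blocks (d : Fin b) (B : List (List (Fin b) × Option (Option ℕ)))
    (q : Option (Letter b) × Bool) (hq : atStart q.1 = true) :
    contextMap (newLetter (some (.inl d))) leftStep rightStep false q (blocks B) =
      blocks (B.map fun u => (u.1, u.2.map (advance d u.1))) := by
  induction B generalizing q with
  | nil => rfl
  | cons u B ih =>
    rw [blocks, List.flatMap_cons, contextMap_append, (contextMap_digit_block _ _ _ _).1, ← blocks,
      ih _ (foldl_leftStep_block _ _ _).1]
    · rfl
    · intro h
      simp [h, atStart] at hq

/-- Deletes the first block whose separator is marked, unless `seen`, and removes all marks. -/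
def deleteFirst : Bool → List (List (Fin b) × Option (Option ℕ)) →
    List (List (Fin b) × Option (Option ℕ))
  | _, [] => []
  | seen, u :: B =>
    (u.1, if decide (u.2 = some (some u.1.length)) && !seen then none
      else u.2.map fun _ => none) ::
      deleteFirst (seen || decide (u.2 = some (some u.1.length))) B

theorem contextMap_separator_blocks (B : List (List (Fin b) × Option (Option ℕ)))
    (q : Option (Letter b) × Bool) :
    contextMap (newLetter (some (.inr ()))) leftStep rightStep false q (blocks B) =
      blocks (deleteFirst q.2 B) := by
  induction B generalizing q with
  | nil => rfl
  | cons u B ih =>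
    rw [blocks, List.flatMap_cons, contextMap_append, contextMap_separator_block, ← blocks, ih,
      (foldl_leftStep_block _ _ _).2]
    rfl

theorem foldl_collectMarked_blocks (B : List (List (Fin b) × Option (Option ℕ))) :
    (blocks B).foldl collectMarked ∅ = {s | ∃ u ∈ B, ∃ k, u.2 = some (some k) ∧
      (u.1.map Sum.inl ++ [Sum.inr ()])[k]? = some s} := by
  rw [foldl_collectMarked]
  ext s
  simp [blocks, marked_mem_block]

theorem isAlive_blocks (B : List (List (Fin b) × Option (Option ℕ))) :
    IsAlive (blocks B) ↔ ∃ u ∈ B, u.2 ≠ none := by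
  simp only [IsAlive, blocks, List.mem_flatMap]
  constructor
  · rintro ⟨a, ⟨u, hu, ha⟩, h⟩
    exact ⟨u, hu, exists_present_mem_block.1 ⟨a, ha, h⟩⟩
  · rintro ⟨u, hu, h⟩
    obtain ⟨a, ha, h⟩ := exists_present_mem_block.2 h
    exact ⟨a, ⟨u, hu, ha⟩, h⟩

end SelectionSort

/-! ### Rounds of the selection sort and correctness of the output -/

namespace SelectionSort

variable {b : ℕ}

/-- The blocks of a list of words, each with a flag that tells whether it is present, where `f`
tells the position of the mark in each present word. -/
def marking (W : List (List (Fin b) × Bool)) (f : List (Fin b) → Option ℕ) :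
    List (List (Fin b) × Option (Option ℕ)) :=
  W.map fun u => (u.1, if u.2 then some (f u.1) else none)

/-- The words that are present. -/
def present (W : List (List (Fin b) × Bool)) : List (List (Fin b)) :=
  (W.filter fun u => u.2).map fun u => u.1

/-- Removes the first present occurrence of the word `w`. -/
def remove (w : List (Fin b)) : List (List (Fin b) × Bool) → List (List (Fin b) × Bool)
  | [] => []
  | u :: W => if u.1 = w ∧ u.2 = true then (u.1, false) :: W else u :: remove w W

theorem mem_present {W : List (List (Fin b) × Bool)} {w : List (Fin b)} :
    w ∈ present W ↔ (w, true) ∈ W := by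
  simp [present]

theorem present_remove (w : List (Fin b)) (W : List (List (Fin b) × Bool)) :
    present (remove w W) = (present W).erase w := by
  induction W with
  | nil => rfl
  | cons u W ih =>
    obtain ⟨v, t⟩ := u
    rw [remove]
    cases t with
    | false => simpa [present] using ih
    | true =>
      by_cases hv : v = w
      · simp [hv, present]
      · have h : (present ((v, true) :: W)) = v :: present W := by simp [present]
        have h' : ∀ W', present ((v, true) :: W') = v :: present W' := by simp [present]
        simp only [hv, false_and, if_false, h', ih]
        rw [List.erase_cons_tail (by simpa using hv)]

theorem isAlive_marking (W : List (List (Fin b) × Bool)) (f : List (Fin b) → Option ℕ) :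
    IsAlive (blocks (marking W f)) ↔ present W ≠ [] := by
  rw [isAlive_blocks]
  constructor
  · rintro ⟨_, hu, h⟩
    obtain ⟨⟨w, t⟩, hw, rfl⟩ := List.mem_map.1 hu
    cases t with
    | false => simp at h
    | true => exact List.ne_nil_of_mem (mem_present.2 hw)
  · intro h
    obtain ⟨w, hw⟩ := List.exists_mem_of_ne_nil _ h
    exact ⟨_, List.mem_map.2 ⟨_, mem_present.1 hw, rfl⟩, by simp⟩

theorem leastMarked_marking (W : List (List (Fin b) × Bool)) (f : List (Fin b) → Option ℕ) :
    leastMarked (blocks (marking W f)) = minSymbol {s | ∃ w ∈ present W, ∃ k, f w = some k ∧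
      (w.map Sum.inl ++ [Sum.inr ()])[k]? = some s} := by
  rw [leastMarked, foldl_collectMarked_blocks]
  congr 1
  ext s
  simp only [marking, List.mem_map, mem_present, Set.mem_ofPred_eq]
  constructor
  · rintro ⟨_, ⟨⟨w, t⟩, hu, rfl⟩, k, h1, h2⟩
    cases t with
    | false => simp at h1
    | true => exact ⟨w, hu, k, by simpa using h1, h2⟩
  · rintro ⟨w, hw, k, h1, h2⟩
    exact ⟨_, ⟨_, hw, rfl⟩, k, by simp [h1], h2⟩

theorem marking_congr {W : List (List (Fin b) × Bool)} {f g : List (Fin b) → Option ℕ}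
    (h : ∀ w ∈ present W, f w = g w) : marking W f = marking W g := by
  refine List.map_congr_left ?_
  rintro ⟨w, t⟩ hu
  cases t with
  | false => rfl
  | true => simp [h w (mem_present.2 hu)]

theorem map_marking (W : List (List (Fin b) × Bool)) (f : List (Fin b) → Option ℕ)
    (g : List (Fin b) → Option ℕ → Option ℕ) :
    (marking W f).map (fun u => (u.1, u.2.map (g u.1))) = marking W fun w => g w (f w) := by
  simp only [marking, List.map_map]
  refine List.map_congr_left ?_
  rintro ⟨w, t⟩ -
  cases t <;> rfl

/-- The mark in `v` is at position `j` if `v` and `w` agree up to there. -/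
def prefixMark (w : List (Fin b)) (j : ℕ) (v : List (Fin b)) : Option ℕ :=
  if v.take j = w.take j then some j else none

/-- A pass also writes its output. -/
noncomputable def cycle (z : List (Letter b) × List (Letter b)) :
    List (Letter b) × List (Letter b) :=
  (pass z.1, z.2 ++ output z.1)

/-- The word `w` is arbitrary, since all words share the empty prefix. Nothing is written in this
cycle. -/
theorem cycle_unmarked (W : List (List (Fin b) × Bool)) (w : List (Fin b)) (o : List (Letter b)) :
    cycle (blocks (marking W fun _ => none), o) = (blocks (marking W (prefixMark w 0)), o) := by
  have h : leastMarked (blocks (marking W fun _ => none)) = none := by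
    rw [leastMarked_marking]
    simp [minSymbol_empty]
  rw [cycle, pass, output, h, contextMap_none_blocks _ _ rfl]
  have := map_marking W (fun _ => none) fun _ _ => some 0
  rw [this]
  have h0 : prefixMark w 0 = fun _ => some 0 := by
    funext v
    simp [prefixMark]
  simp [h0]

theorem deleteFirst_true (W : List (List (Fin b) × Bool)) (f : List (Fin b) → Option ℕ) :
    deleteFirst true (marking W f) = marking W fun _ => none := by
  induction W with
  | nil => rfl
  | cons u W ih =>
    obtain ⟨w, t⟩ := u
    simp only [marking] at ih
    cases t <;> simp [marking, deleteFirst, ih]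

theorem deleteFirst_false {W : List (List (Fin b) × Bool)} {f : List (Fin b) → Option ℕ}
    {w : List (Fin b)} (h : ∀ v ∈ present W, f v = some v.length ↔ v = w) :
    deleteFirst false (marking W f) = marking (remove w W) fun _ => none := by
  induction W with
  | nil => rfl
  | cons u W ih =>
    obtain ⟨v, t⟩ := u
    cases t with
    | false =>
      have := ih fun v hv => h v (by simpa [present] using hv)
      simp only [marking] at this
      simp [marking, deleteFirst, remove, this]
    | true =>
      have hv := h v (by simp [present])
      have := ih fun v hv => h v (by simp [mem_present] at hv ⊢; tauto)
      have h2 := deleteFirst_true W f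
      simp only [marking] at this h2
      by_cases hvw : v = w
      · simp [marking, deleteFirst, remove, hv.2 hvw, h2, if_pos hvw]
      · simp [marking, deleteFirst, remove, this, mt hv.1 hvw, if_neg hvw]

/-- Among the present words that share the first `j` digits of the minimum `w`, none has a smaller
next digit. So `w[j]` is the least marked symbol, and the marks that survive are those of the words
that also agree in this digit. -/
theorem cycle_digit {m : ℕ} {W : List (List (Fin b) × Bool)} {w : List (Fin b)}
    (hm : ∀ v ∈ present W, v.length = m) (hw : w ∈ present W)
    (hmin : ∀ v ∈ present W, digitsValue w ≤ digitsValue v) (o : List (Letter b)) {j : ℕ}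
    (hj : j < w.length) :
    cycle (blocks (marking W (prefixMark w j)), o) =
      (blocks (marking W (prefixMark w (j + 1))), o ++ [(.inl w[j], some false)]) := by
  have h : leastMarked (blocks (marking W (prefixMark w j))) = some (.inl w[j]) := by
    rw [leastMarked_marking]
    refine minSymbol_eq_some ⟨w, hw, j, by simp [prefixMark], ?_⟩ ?_
    · rw [List.getElem?_append_left (by simpa using hj)]
      simp [hj]
    · rintro s ⟨v, hv, k, hk, hs⟩
      rw [prefixMark] at hk
      split_ifs at hk with htake
      obtain rfl : j = k := by simpa using hk
      have hl : w.length = v.length := by rw [hm v hv, hm w hw]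
      rw [List.getElem?_append_left (by simpa [← hl] using hj)] at hs
      obtain rfl : Sum.inl v[j] = s := by simpa [← hl, hj] using hs
      exact getElem_le_of_digitsValue_le hl htake.symm hj (hl ▸ hj) (hmin v hv)
  rw [cycle, pass, output, h, contextMap_digit_blocks _ _ _ rfl]
  have := map_marking W (prefixMark w j) (advance w[j])
  rw [this]
  refine Prod.ext ?_ (by simp)
  simp only
  congr 1
  refine marking_congr fun v hv => ?_
  have hl : j < v.length := by rw [hm v hv, ← hm w hw]; exact hj
  have hiff : v.take (j + 1) = w.take (j + 1) ↔ v.take j = w.take j ∧ v[j] = w[j] := by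
    rw [List.take_add_one, List.take_add_one, List.getElem?_eq_getElem hl,
      List.getElem?_eq_getElem hj]
    exact ⟨fun h => by simpa using List.append_inj h (by simp; omega), fun h => by rw [h.1, h.2]⟩
  simp only [prefixMark, hiff]
  by_cases h1 : v.take j = w.take j
  · by_cases h2 : v[j] = w[j] <;> simp [advance, h1, h2, hl]
  · simp [h1, advance]

/-- A word of length `m` that agrees with `w` in `m` digits is a copy of `w`. Only the first copy is
deleted, so repeated numbers are output repeatedly. -/
theorem cycle_separator {m : ℕ} {W : List (List (Fin b) × Bool)} {w : List (Fin b)}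
    (hm : ∀ v ∈ present W, v.length = m) (hw : w ∈ present W) (o : List (Letter b)) :
    cycle (blocks (marking W (prefixMark w m)), o) =
      (blocks (marking (remove w W) fun _ => none), o ++ [(.inr (), some false)]) := by
  have hf : ∀ v ∈ present W, prefixMark w m v = some v.length ↔ v = w := by
    intro v hv
    rw [prefixMark, hm v hv, List.take_of_length_le (hm v hv).le,
      List.take_of_length_le (hm w hw).le]
    simp
  have h : leastMarked (blocks (marking W (prefixMark w m))) = some (.inr ()) := by
    rw [leastMarked_marking]
    have hs : ∀ v ∈ present W, (v.map Sum.inl ++ [Sum.inr ()])[m]? = some (.inr () : Fin b ⊕ Unit) := by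
      intro v hv
      rw [List.getElem?_append_right (by simp [hm v hv])]
      simp [hm v hv]
    refine minSymbol_eq_some ⟨w, hw, m, by simp [prefixMark], hs w hw⟩ ?_
    rintro s ⟨v, hv, k, hk, hs'⟩
    rw [prefixMark] at hk
    split_ifs at hk with htake
    obtain rfl : m = k := by simpa using hk
    rw [hs v hv] at hs'
    rw [Option.some.inj hs']
  rw [cycle, pass, output, h, contextMap_separator_blocks, deleteFirst_false hf]
  simp

/-- The word as it is written to the output. -/
def written (w : List (Fin b)) : List (Letter b) :=
  (w.map Sum.inl ++ [Sum.inr ()]).map fun s => (s, some false)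

theorem cycle_iterate_digit {m : ℕ} {W : List (List (Fin b) × Bool)} {w : List (Fin b)}
    (hm : ∀ v ∈ present W, v.length = m) (hw : w ∈ present W)
    (hmin : ∀ v ∈ present W, digitsValue w ≤ digitsValue v) (o : List (Letter b)) {j : ℕ}
    (hj : j ≤ m) :
    cycle^[j + 1] (blocks (marking W fun _ => none), o) =
      (blocks (marking W (prefixMark w j)),
        o ++ (w.take j).map fun d => (Sum.inl d, some false)) := by
  induction j with
  | zero => simp [cycle_unmarked W w]
  | succ j ih =>
    have hj' : j < w.length := by rw [hm w hw]; omega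
    rw [Function.iterate_succ_apply', ih (by omega), cycle_digit hm hw hmin _ hj',
      List.take_add_one, List.map_append, List.getElem?_eq_getElem hj', List.append_assoc]
    rfl

theorem cycle_iterate_round {m : ℕ} {W : List (List (Fin b) × Bool)} {w : List (Fin b)}
    (hm : ∀ v ∈ present W, v.length = m) (hw : w ∈ present W)
    (hmin : ∀ v ∈ present W, digitsValue w ≤ digitsValue v) (o : List (Letter b)) :
    cycle^[m + 2] (blocks (marking W fun _ => none), o) =
      (blocks (marking (remove w W) fun _ => none), o ++ written w) := by
  rw [Function.iterate_succ_apply', cycle_iterate_digit hm hw hmin o le_rfl,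
    cycle_separator hm hw]
  rw [List.take_of_length_le (hm w hw).le]
  simp [written]

/-- Each round moves a minimal word from the store to the output. The claims on `IsAlive` ensure
that the loop of the machine ends at exactly the right time. -/
theorem exists_sorted_output {m : ℕ} (n : ℕ) (W : List (List (Fin b) × Bool))
    (hm : ∀ v ∈ present W, v.length = m) (hn : (present W).length = n) (o : List (Letter b)) :
    ∃ (Y : List (List (Fin b))) (v : List (Letter b)), Y.Perm (present W) ∧
      Y.Pairwise (fun w w' => digitsValue w ≤ digitsValue w') ∧
      cycle^[n * (m + 2)] (blocks (marking W fun _ => none), o) = (v, o ++ Y.flatMap written) ∧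
      ¬ IsAlive v ∧
      ∀ s < n * (m + 2), IsAlive (cycle^[s] (blocks (marking W fun _ => none), o)).1 := by
  induction n generalizing W o with
  | zero =>
    have h := List.length_eq_zero_iff.1 hn
    refine ⟨[], blocks (marking W fun _ => none), by rw [h], .nil, by simp, ?_, by simp⟩
    rw [isAlive_marking, h]
    simp
  | succ n ih =>
    have hne : present W ≠ [] := by
      intro h
      simp [h] at hn
    obtain ⟨w, hw, hmin⟩ := (present W).toFinset.exists_min_image digitsValue (by simpa using hne)
    simp only [List.mem_toFinset] at hw hmin
    have hp := present_remove w W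
    obtain ⟨Y, v, h1, h2, h3, h4, h5⟩ := ih (remove w W)
      (fun v hv => hm v (List.mem_of_mem_erase (hp ▸ hv)))
      (by rw [hp, List.length_erase_of_mem hw, hn]; rfl) (o ++ written w)
    rw [hp] at h1
    refine ⟨w :: Y, v, ?_, ?_, ?_, h4, ?_⟩
    · exact (h1.cons w).trans (List.perm_cons_erase hw).symm
    · refine List.pairwise_cons.2 ⟨fun v hv => hmin v ?_, h2⟩
      exact List.mem_of_mem_erase (h1.mem_iff.1 hv)
    · rw [add_mul, one_mul, Function.iterate_add_apply, cycle_iterate_round hm hw hmin, h3]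
      simp
    · intro s hs
      by_cases hs' : s < m + 2
      · cases s with
        | zero => exact (isAlive_marking _ _).2 hne
        | succ s =>
          rw [cycle_iterate_digit hm hw hmin _ (by omega)]
          exact (isAlive_marking _ _).2 hne
      · obtain ⟨d, rfl⟩ := Nat.exists_eq_add_of_le (not_lt.1 hs')
        rw [add_comm, Function.iterate_add_apply, cycle_iterate_round hm hw hmin]
        refine h5 d ?_
        rw [add_mul] at hs
        omega

theorem perm_sortNumbers {n m : ℕ} (x : Fin n → Fin m → Fin b) :
    (List.ofFn (sortNumbers x)).Perm (List.ofFn x) :=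
  Equiv.Perm.ofFn_comp_perm _ _

/-- Words of equal length and equal value are equal, so there is only one sorted arrangement and
stability is no issue. -/
theorem eq_ofFn_sortNumbers {n m : ℕ} (x : Fin n → Fin m → Fin b) {Y : List (List (Fin b))}
    (hY : Y.Perm ((List.ofFn x).map List.ofFn))
    (hs : Y.Pairwise fun w w' => digitsValue w ≤ digitsValue w') :
    Y = (List.ofFn (sortNumbers x)).map List.ofFn := by
  have hp : ((List.ofFn (sortNumbers x)).map List.ofFn).Perm ((List.ofFn x).map List.ofFn) :=
    (perm_sortNumbers x).map _
  have hlen : ∀ w ∈ (List.ofFn x).map List.ofFn, w.length = m := by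
    intro w hw
    obtain ⟨v, -, rfl⟩ := List.mem_map.1 hw
    simp
  refine List.Perm.eq_of_pairwise ?_ hs ?_ (hY.trans hp.symm)
  · intro w w' hw hw' h h'
    exact digitsValue_injective
      ((hlen w (hY.mem_iff.1 hw)).trans (hlen w' (hp.mem_iff.1 hw')).symm) (le_antisymm h h')
  · rw [List.pairwise_map, List.pairwise_ofFn]
    intro i j hij
    rw [digitsValue_ofFn, digitsValue_ofFn]
    exact sortNumbers_mono x hij.le

theorem encodeNumbers_eq {n m : ℕ} (x : Fin n → Fin m → Fin b) :
    (encodeNumbers x).map (fun s => (s, some false)) =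
      ((List.ofFn x).map List.ofFn).flatMap written := by
  rw [encodeNumbers, List.map_flatten, List.flatMap_def, List.map_map, List.map_ofFn, List.map_ofFn]
  congr 2
  funext i
  simp [written, List.map_ofFn, Function.comp_def]

theorem block_unmarked (w : List (Fin b)) : block w (some none) = written w := by
  induction w with
  | nil => rfl
  | cons d w ih => simpa [block, written, firstAnnotation, tailStatus] using ih

theorem blocks_unmarked (L : List (List (Fin b))) :
    blocks (marking (L.map fun w => (w, true)) fun _ => none) = L.flatMap written := by
  simp [blocks, marking, List.flatMap_map, block_unmarked]

end SelectionSort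

/-! ### The machine and its running time -/

namespace SelectionSort

open DARM

/-- The machine that sorts by selection. Each execution of the loop writes one symbol at most. -/
noncomputable def machine (b : ℕ) : DARM (Fin b ⊕ Unit) where
  Alphabet := Letter b
  finite_alphabet := inferInstance
  incl := ⟨fun s => (s, some false), fun _ _ h => (Prod.mk.inj h).1⟩
  numRegs := 2
  program :=
    [.read 0, .apply 1 (outputFun b) (fun _ => 0), .write 1, .apply 0 (passFun b) (fun _ => 0),
      .ifGoto (alivePred b) (fun _ => 0) 1, .halt]

variable {b : ℕ}

/-- A string over the input alphabet as a string over the machine alphabet. -/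
def unmarked (x : List (Fin b ⊕ Unit)) : List (Letter b) :=
  x.map fun s => (s, some false)

/-- The configuration of the machine in a given line, while it is running. -/
def runningAt (l : ℕ) (v u o : List (Letter b)) :
    Config (machine b).Alphabet (machine b).numRegs where
  line := l
  reg := ![v, u]
  out := o
  status := .running

/-- One execution of the loop realizes one `cycle`. The output is computed before the pass
overwrites the string on which it depends. -/
theorem step_loop (x : List (Fin b ⊕ Unit)) (v u o : List (Letter b)) :
    (IsAlive (pass v) → ((machine b).step x)^[4] (runningAt 1 v u o) =
      runningAt 1 (pass v) (output v) (o ++ output v)) ∧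
    (¬ IsAlive (pass v) → ((machine b).step x)^[4] (runningAt 1 v u o) =
      runningAt 5 (pass v) (output v) (o ++ output v)) := by
  have h1 : (machine b).step x (runningAt 1 v u o) = runningAt 2 v (output v) o := by
    have h : Function.update ![v, u] 1 (output v) = ![v, output v] := by
      funext i
      fin_cases i <;> rfl
    exact congrArg (fun r => (⟨2, r, o, .running⟩ : Config (Letter b) 2)) h
  have h2 : (machine b).step x (runningAt 2 v (output v) o) =
      runningAt 3 v (output v) (o ++ output v) := rfl
  have h3 : (machine b).step x (runningAt 3 v (output v) (o ++ output v)) =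
      runningAt 4 (pass v) (output v) (o ++ output v) := by
    have h : Function.update ![v, output v] 0 (pass v) = ![pass v, output v] := by
      funext i
      fin_cases i <;> rfl
    exact congrArg (fun r => (⟨4, r, o ++ output v, .running⟩ : Config (Letter b) 2)) h
  have h4 : ∀ u o : List (Letter b), (machine b).step x (runningAt 4 (pass v) u o) =
      { runningAt 4 (pass v) u o with line := open Classical in if IsAlive (pass v) then 1 else 5 } :=
    fun u o => rfl
  simp only [Function.iterate_succ_apply', Function.iterate_zero, id_eq, h1, h2, h3, h4]
  constructor <;> intro h <;> simp [h, runningAt]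

theorem iterate_loop (x : List (Fin b ⊕ Unit)) (v o : List (Letter b)) (T : ℕ)
    (h : ∀ s < T, IsAlive (cycle^[s] (v, o)).1) (u : List (Letter b)) :
    ∀ s < T, ∃ u', ((machine b).step x)^[4 * s] (runningAt 1 v u o) =
      runningAt 1 (cycle^[s] (v, o)).1 u' (cycle^[s] (v, o)).2 := by
  intro s hs
  induction s with
  | zero => exact ⟨u, rfl⟩
  | succ s ih =>
    obtain ⟨u', hu'⟩ := ih (by omega)
    refine ⟨output (cycle^[s] (v, o)).1, ?_⟩
    have := h (s + 1) hs
    rw [Function.iterate_succ_apply'] at this ⊢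
    rw [mul_add, mul_one, add_comm, Function.iterate_add_apply, hu']
    exact (step_loop x _ u' _).1 this

theorem outputsInSteps_machine (x y : List (Fin b ⊕ Unit)) (T : ℕ) (v : List (Letter b))
    (hT : cycle^[T + 1] (unmarked x, []) = (v, unmarked y))
    (hv : ¬ IsAlive v)
    (h : ∀ s < T + 1, IsAlive (cycle^[s] (unmarked x, [])).1) :
    (machine b).OutputsInSteps x y (1 + 4 * (T + 1) + 1) := by
  have h0 : (machine b).run x 1 = runningAt 1 (unmarked x) [] [] := by
    have h : (Function.update (fun _ => []) 0 (unmarked x) : Fin 2 → List (Letter b)) =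
        ![unmarked x, []] := by
      funext i
      fin_cases i <;> rfl
    exact congrArg (fun r => (⟨1, r, [], .running⟩ : Config (Letter b) 2)) h
  obtain ⟨u, hu⟩ := iterate_loop x _ _ _ h [] T (by omega)
  rw [Function.iterate_succ_apply'] at hT
  have hv' : pass (cycle^[T] (unmarked x, [])).1 = v := congrArg Prod.fst hT
  have ho : (cycle^[T] (unmarked x, [])).2 ++
      output (cycle^[T] (unmarked x, [])).1 = unmarked y :=
    congrArg Prod.snd hT
  have hend : (machine b).run x (1 + 4 * (T + 1)) =
      runningAt 5 v (output (cycle^[T] (unmarked x, [])).1)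
        (unmarked y) := by
    rw [run_add, h0, mul_add, mul_one, add_comm, Function.iterate_add_apply, hu,
      (step_loop x _ u _).2 (by rwa [hv']), hv', ho]
  have hlast : (machine b).run x (1 + 4 * (T + 1) + 1) =
      { (machine b).run x (1 + 4 * (T + 1)) with status := .halted } := by
    rw [run_add, hend]
    rfl
  refine ⟨fun s hs => ?_, Or.inl (by rw [hlast]), by rw [hlast, hend]; rfl⟩
  -- A halted configuration would persist, but the machine is still running when it reaches the last
  -- line.
  by_contra hne
  have := (machine b).run_eq_of_status_ne hne (Nat.lt_succ_iff.1 hs)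
  rw [hend] at this
  rw [← this] at hne
  exact hne rfl

theorem sortsInSteps_machine {n m : ℕ} (hn : 1 ≤ n) (x : Fin n → Fin m → Fin b) :
    (machine b).SortsInSteps x (1 + 4 * (n * (m + 2)) + 1) := by
  set L := (List.ofFn x).map List.ofFn with hL
  set W := L.map fun w => (w, true) with hW
  have hp : present W = L := by
    simp [hW, present, List.filter_map, Function.comp_def]
  have hx : ∀ z : Fin n → Fin m → Fin b, unmarked (encodeNumbers z) =
      ((List.ofFn z).map List.ofFn).flatMap written := encodeNumbers_eq
  obtain ⟨Y, v, h1, h2, h3, h4, h5⟩ := exists_sorted_output (m := m) n W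
    (by rw [hp]; intro w hw; obtain ⟨v, -, rfl⟩ := List.mem_map.1 hw; simp)
    (by rw [hp]; simp [hL]) []
  rw [hp] at h1
  rw [eq_ofFn_sortNumbers x h1 h2, blocks_unmarked, ← hx, ← hx, List.nil_append] at h3
  rw [blocks_unmarked, ← hx] at h5
  -- The loop tests its condition at the end, so at least one cycle is needed.
  obtain ⟨T, hT⟩ : ∃ T, n * (m + 2) = T + 1 :=
    Nat.exists_eq_succ_of_ne_zero (by positivity)
  rw [hT] at h3 h5 ⊢
  exact outputsInSteps_machine _ _ T v h3 h4 h5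

end SelectionSort

theorem mainTheorem12 (b : ℕ) (hb : 2 ≤ b) :
    (∃ (M : DARM (Fin b ⊕ Unit)) (C : ℕ), ∀ n m : ℕ, 1 ≤ n → 1 ≤ m →
      ∀ x : Fin n → Fin m → Fin b, ∃ t : ℕ, t ≤ C * (n * m) ∧ M.SortsInSteps x t) ∧
    (∀ M : DARM (Fin b ⊕ Unit),
      (∀ n m : ℕ, 1 ≤ n → 1 ≤ m → ∀ x : Fin n → Fin m → Fin b, ∃ t : ℕ, M.SortsInSteps x t) →
      ∀ ε : ℝ, 0 < ε → ∃ c : ℝ, 0 < c ∧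
        ∀ n m : ℕ, 2 ≤ n → (1 + ε) * Real.logb b n ≤ m →
          ∃ (x : Fin n → Fin m → Fin b) (t : ℕ),
            M.SortsInSteps x t ∧ c * ((n : ℝ) * (m : ℝ)) ≤ (t : ℝ)) := by
  refine ⟨⟨SelectionSort.machine b, 14, fun n m hn hm x =>
    ⟨_, ?_, SelectionSort.sortsInSteps_machine hn x⟩⟩,
    fun M hM ε hε => M.exists_le_steps_of_sorts hb hM ε hε⟩
  -- The machine takes `4 * n * m + 8 * n + 2` steps, and both `n` and 1 are at most `n * m`, whence
  -- the constant 14.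
  have h1 : n ≤ n * m := Nat.le_mul_of_pos_right n hm
  rw [mul_add]
  omega
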